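/- Consider the system $x^+=Ax+Bu$, $y=Cx+Du$ with $x\in\mathbb R^n$, $u\in\mathbb R^m$, $y\in\mathbb R^p$, $(A,B)$ stabilizable, and the constraint $(x,u)\in\mathcal Z$, where $\mathcal Z\subset\mathbb R^{n+m}$ is a closed convex polyhedron with non-empty interior, $0\in\mathcal Z$, and compact projection onto the $u$-coordinates. Fix $\lambda\in[0,1)$ and let $$\mathcal Z_{sp}=\{(x_s,u_s): x_s=Ax_s+Bu_s,\ (x_s,u_s)\in\lambda\mathcal Z\},\qquad \mathcal Y_{sp}=\{Cx_s+Du_s:(x_s,u_s)\in\mathcal Z_{sp}\}.$$ Let $N\ge 1$; let $R\succ0$ and $Q\succeq0$ with $(Q^{1/2},A)$ observable; let $A+BK$ have all its eigenvalues inside the open unit disc; let $P\succ0$ satisfy $(A+BK)'P(A+BK)-P\preceq-(Q+K'RK)$; and let $\Omega_t^a\subseteq\mathbb R^{2n+m}$ be a polyhedron such that every $(x,x_a,u_a)\in\Omega_t^a$ satisfies $(x,K(x-x_a)+u_a)\in\mathcal Z$, $(x_a,u_a)\in\mathcal Z_{sp}$ and $(Ax+B(K(x-x_a)+u_a),x_a,u_a)\in\Omega_t^a$.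 For a function $V_O(y,y_{sp})$ and with $\|v\|_W^2=v'Wv$, the MPC for tracking is the problem $$V_N^0(x,y_{sp})=\min_{\mathbf u,x_a,u_a}\ \sum_{j=0}^{N-1}\big(\|x(j)-x_a\|_Q^2+\|u(j)-u_a\|_R^2\big)+\|x(N)-x_a\|_P^2+V_O(Cx_a+Du_a,y_{sp})$$ subject to $x(0)=x$, $x(j+1)=Ax(j)+Bu(j)$, $(x(j),u(j))\in\mathcal Z$ for $0\le j<N$, and $(x(N),x_a,u_a)\in\Omega_t^a$. The MPC for regulation, with value $V_N^{r,0}(x,y_{sp})$, is the same problem without the term $V_O$ and with the additional constraint $Cx_a+Du_a=y_{sp}$; $\mathcal X_N^r(y_{sp})$ is the set of $x$ for which it is feasible. The control laws $\kappa_N(x,y_{sp})$ and $\kappa_N^r(x,y_{sp})$ are the first inputs $u(0)$ of the optimal solutions (understood as the set of all such first inputs if the optimal solution is not unique). Let $\|\cdot\|$ be any norm on $\mathbb R^p$, and let $S\subseteq\mathbb R^n\times\mathbb R^p$ be a set of parameters $(x,y_{sp})$. Assume that $\mathcal Z$ is bounded (in which case $S=\mathbb R^n\times\mathbb R^p$ is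 allowed) or that $S$ is bounded. Then there is $\gamma^*>0$ such that for all $\gamma\ge\gamma^*$, every $y_{sp}\in\mathbb R^p$ and every $V_O$ such that $V_O(\cdot,y_{sp})$ is real-valued on $\mathbb R^p$, convex, subdifferentiable, nonnegative, zero exactly at $y=y_{sp}$, has a unique minimizer over $\mathcal Y_{sp}$, and satisfies $$V_O(y,y_{sp})\ge\gamma\|y-y_{sp}\|\qquad\text{for all }y\in\mathcal Y_{sp},$$ the following hold. 1. For all $x\in\mathcal X_N^r(y_{sp})$ with $(x,y_{sp})\in S$: both minima are attained, $V_N^0(x,y_{sp})=V_N^{r,0}(x,y_{sp})$ and $\kappa_N(x,y_{sp})=\kappa_N^r(x,y_{sp})\neq\emptyset$. If $\ker B\cap\ker D=\{0\}$, both laws are single-valued at $(x,y_{sp})$. 2. Suppose moreover that $K$ and $P$ are the gain and the cost matrix of the unconstrained LQR, i.e. $P=Q+A'PA-A'PB(R+B'PB)^{-1}B'PA$ and $K=-(R+B'PB)^{-1}B'PA$. Let $(x_{sp},u_{sp})$ be an equilibrium with output $y_{sp}$, and suppose that no other point of $\mathcal Z_{sp}$ has output $y_{sp}$. Let $\kappa_\infty$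 be a constrained infinite-horizon optimal law: from every state from which some state feedback law satisfies the constraints along the whole closed-loop evolution, $\kappa_\infty$ does so too and minimizes, among all such laws $\kappa$, the cost $\sum_{j\ge0}\|x(j)-x_{sp}\|_Q^2+\|\kappa(x(j))-u_{sp}\|_R^2\in[0,\infty]$. Let $\Upsilon_N(y_{sp})$ be the set of states $x$ from which $\kappa_\infty$ is admissible and whose closed-loop state $x(N)$ under $\kappa_\infty$ satisfies $(x(N),x_{sp},u_{sp})\in\Omega_t^a$. Then $\kappa_N(x,y_{sp})=\{\kappa_\infty(x)\}$ for all $x\in\Upsilon_N(y_{sp})$ with $(x,y_{sp})\in S$. -/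

import Mathlib

open scoped Pointwise Matrix ENNReal

namespace MPCT

/-- A polyhedron: the intersection of finitely many closed half-spaces. -/
def IsPolyhedron {E : Type*} [AddCommGroup E] [Module ℝ E] (s : Set E) : Prop :=
  ∃ (k : ℕ) (f : Fin k → (E →ₗ[ℝ] ℝ)) (c : Fin k → ℝ), s = {z | ∀ i, f i z ≤ c i}

/-- All (complex) eigenvalues lie strictly inside the unit circle. -/
def IsSchur {n : ℕ} (F : Matrix (Fin n) (Fin n) ℝ) : Prop :=
  ∀ z ∈ spectrum ℂ (F.map (algebraMap ℝ ℂ)), ‖z‖ < 1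

/-- The pair `(A, B)` is stabilizable. -/
def Stabilizable {n m : ℕ} (A : Matrix (Fin n) (Fin n) ℝ) (B : Matrix (Fin n) (Fin m) ℝ) : Prop :=
  ∃ F : Matrix (Fin m) (Fin n) ℝ, IsSchur (A + B * F)

/-- The pair `(H, A)` is observable: only the zero initial state produces the zero output
of `x⁺ = A x`, `y = H x`. -/
def Observable {n q : ℕ} (H : Matrix (Fin q) (Fin n) ℝ) (A : Matrix (Fin n) (Fin n) ℝ) : Prop :=
  ∀ x : Fin n → ℝ, (∀ k : ℕ, H *ᵥ (A ^ k *ᵥ x) = 0) → x = 0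

/-- The squared weighted norm `‖v‖²_W = v' W v`. -/
noncomputable def wsq {k : ℕ} (W : Matrix (Fin k) (Fin k) ℝ) (v : Fin k → ℝ) : ℝ :=
  v ⬝ᵥ (W *ᵥ v)

/-- The data of the controllers: the plant `x⁺ = A x + B u`, `y = C x + D u`, the constraint set
`Z`, the contraction factor `lam`, the horizon `N`, the weights `Q`, `R`, `P`, the terminal gain `K`
and the extended terminal set `Omega` of triples `(x, x_a, u_a)`. -/
structure Design (n m p : ℕ) where
  A : Matrix (Fin n) (Fin n) ℝ
  B : Matrix (Fin n) (Fin m) ℝ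
  C : Matrix (Fin p) (Fin n) ℝ
  D : Matrix (Fin p) (Fin m) ℝ
  Z : Set ((Fin n → ℝ) × (Fin m → ℝ))
  lam : ℝ
  N : ℕ
  Q : Matrix (Fin n) (Fin n) ℝ
  R : Matrix (Fin m) (Fin m) ℝ
  P : Matrix (Fin n) (Fin n) ℝ
  K : Matrix (Fin m) (Fin n) ℝ
  Omega : Set ((Fin n → ℝ) × (Fin n → ℝ) × (Fin m → ℝ))

namespace Design

variable {n m p : ℕ} (M : Design n m p)

/-- The successor state. -/
def next (x : Fin n → ℝ) (u : Fin m → ℝ) : Fin n → ℝ := M.A *ᵥ x + M.B *ᵥ u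

/-- The output. -/
def out (x : Fin n → ℝ) (u : Fin m → ℝ) : Fin p → ℝ := M.C *ᵥ x + M.D *ᵥ u

/-- The set `Z_sp` of reachable (admissible) equilibrium points. -/
def Zsp : Set ((Fin n → ℝ) × (Fin m → ℝ)) := {z | z.1 = M.next z.1 z.2 ∧ z ∈ M.lam • M.Z}

/-- The set `Y_sp` of reachable setpoints. -/
def Ysp : Set (Fin p → ℝ) := {y | ∃ z ∈ M.Zsp, y = M.out z.1 z.2}

/-- The assumptions on the plant, its constraints, and the design parameters. -/
structure Standing : Prop where
  polyhedron : IsPolyhedron M.Z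
  interior_nonempty : (interior M.Z).Nonempty
  zero_mem : (0 : (Fin n → ℝ) × (Fin m → ℝ)) ∈ M.Z
  input_compact : IsCompact (Prod.snd '' M.Z)
  lam_nonneg : 0 ≤ M.lam
  lam_lt_one : M.lam < 1
  horizon : 1 ≤ M.N
  stabilizable : Stabilizable M.A M.B
  R_posDef : M.R.PosDef
  Q_posSemidef : M.Q.PosSemidef
  /-- `(Q^{1/2}, A)` is observable; `H` is the positive semidefinite square root of `Q`. -/
  observable : ∃ H : Matrix (Fin n) (Fin n) ℝ, H.PosSemidef ∧ H * H = M.Q ∧ Observable H M.A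
  K_stabilizing : IsSchur (M.A + M.B * M.K)
  P_posDef : M.P.PosDef
  /-- `(A+BK)' P (A+BK) - P ≤ -(Q + K' R K)`. -/
  lyapunov : (-(M.Q + M.Kᵀ * M.R * M.K)
    - ((M.A + M.B * M.K)ᵀ * M.P * (M.A + M.B * M.K) - M.P)).PosSemidef
  Omega_polyhedron : IsPolyhedron M.Omega
  /-- `Omega` is an admissible invariant set for tracking for the gain `K`. -/
  Omega_invariant : ∀ x xa ua, (x, xa, ua) ∈ M.Omega →
    (x, M.K *ᵥ (x - xa) + ua) ∈ M.Z ∧ (xa, ua) ∈ M.Zsp ∧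
    (M.next x (M.K *ᵥ (x - xa) + ua), xa, ua) ∈ M.Omega

/-- `VO(·, ysp)` is an offset cost function at the setpoint `ysp`: convex, positive definite in the
offset, subdifferentiable, with a unique minimizer over the reachable setpoints. -/
structure IsOffsetCost (VO : (Fin p → ℝ) → (Fin p → ℝ) → ℝ) (ysp : Fin p → ℝ) : Prop where
  convex : ConvexOn ℝ Set.univ (fun y => VO y ysp)
  nonneg : ∀ y, 0 ≤ VO y ysp
  eq_zero_iff : ∀ y, VO y ysp = 0 ↔ y = ysp
  subdifferentiable : ∀ y, ∃ g : Fin p → ℝ, ∀ z, VO y ysp + g ⬝ᵥ (z - y) ≤ VO z ysp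
  unique_minimizer : ∃! y, y ∈ M.Ysp ∧ ∀ z ∈ M.Ysp, VO y ysp ≤ VO z ysp

/-- The predicted state `x(j)` under the input sequence `u` from the initial state `x`. -/
def traj (x : Fin n → ℝ) (u : ℕ → Fin m → ℝ) : ℕ → Fin n → ℝ
  | 0 => x
  | j + 1 => M.next (traj x u j) (u j)

/-- The tracking part of the cost: the stage costs for `j < N` plus the terminal cost. -/
noncomputable def regCost (x : Fin n → ℝ) (u : ℕ → Fin m → ℝ)
    (xa : Fin n → ℝ) (ua : Fin m → ℝ) : ℝ :=
  (∑ j ∈ Finset.range M.N, (wsq M.Q (M.traj x u j - xa) + wsq M.R (u j - ua)))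
    + wsq M.P (M.traj x u M.N - xa)

/-- The cost function of the MPC for tracking. -/
noncomputable def trackCost (VO : (Fin p → ℝ) → (Fin p → ℝ) → ℝ) (x : Fin n → ℝ)
    (ysp : Fin p → ℝ) (u : ℕ → Fin m → ℝ) (xa : Fin n → ℝ) (ua : Fin m → ℝ) : ℝ :=
  M.regCost x u xa ua + VO (M.out xa ua) ysp

/-- Feasibility for the MPC for tracking. Only `u 0, …, u (N - 1)` enter the constraints and the
costs. -/
def TrackFeasible (x : Fin n → ℝ) (u : ℕ → Fin m → ℝ) (xa : Fin n → ℝ) (ua : Fin m → ℝ) : Prop :=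
  (∀ j < M.N, (M.traj x u j, u j) ∈ M.Z) ∧ (M.traj x u M.N, xa, ua) ∈ M.Omega

/-- Feasibility for the MPC for regulation: the artificial output must equal the setpoint. -/
def RegFeasible (x : Fin n → ℝ) (ysp : Fin p → ℝ) (u : ℕ → Fin m → ℝ)
    (xa : Fin n → ℝ) (ua : Fin m → ℝ) : Prop :=
  M.TrackFeasible x u xa ua ∧ M.out xa ua = ysp

/-- The feasible set `X_N^r(ysp)` of the MPC for regulation. -/
def regRegion (ysp : Fin p → ℝ) : Set (Fin n → ℝ) :=
  {x | ∃ u xa ua, M.RegFeasible x ysp u xa ua}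

/-- The costs attained by feasible points of the MPC for tracking; `V_N^0(x, ysp)` is the least
element. -/
def trackValues (VO : (Fin p → ℝ) → (Fin p → ℝ) → ℝ) (x : Fin n → ℝ) (ysp : Fin p → ℝ) : Set ℝ :=
  {v | ∃ u xa ua, M.TrackFeasible x u xa ua ∧ v = M.trackCost VO x ysp u xa ua}

/-- The costs attained by feasible points of the MPC for regulation; `V_N^{r,0}(x, ysp)` is the
least element. -/
def regValues (x : Fin n → ℝ) (ysp : Fin p → ℝ) : Set ℝ :=
  {v | ∃ u xa ua, M.RegFeasible x ysp u xa ua ∧ v = M.regCost x u xa ua}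

/-- The control law `κ_N(x, ysp)` of the MPC for tracking, as the set of the first inputs `u(0)` of
all optimal solutions. -/
def trackLaw (VO : (Fin p → ℝ) → (Fin p → ℝ) → ℝ) (x : Fin n → ℝ) (ysp : Fin p → ℝ) :
    Set (Fin m → ℝ) :=
  {v | ∃ u xa ua, M.TrackFeasible x u xa ua ∧
    (∀ u' xa' ua', M.TrackFeasible x u' xa' ua' →
      M.trackCost VO x ysp u xa ua ≤ M.trackCost VO x ysp u' xa' ua') ∧ v = u 0}

/-- The control law `κ_N^r(x, ysp)` of the MPC for regulation, as the set of the first inputs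
`u(0)` of all optimal solutions. -/
def regLaw (x : Fin n → ℝ) (ysp : Fin p → ℝ) : Set (Fin m → ℝ) :=
  {v | ∃ u xa ua, M.RegFeasible x ysp u xa ua ∧
    (∀ u' xa' ua', M.RegFeasible x ysp u' xa' ua' →
      M.regCost x u xa ua ≤ M.regCost x u' xa' ua') ∧ v = u 0}

/-- `(xsp, usp)` is the equilibrium point associated to the setpoint `ysp`: it is an equilibrium
with output `ysp`, and there is no other admissible one. -/
def IsTheEquilibrium (ysp : Fin p → ℝ) (xsp : Fin n → ℝ) (usp : Fin m → ℝ) : Prop :=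
  xsp = M.next xsp usp ∧ M.out xsp usp = ysp ∧
    ∀ z ∈ M.Zsp, M.out z.1 z.2 = ysp → z = (xsp, usp)

/-- `K` is the gain and `P` the optimal cost matrix of the unconstrained linear quadratic regulator,
given by the discrete algebraic Riccati equation. -/
def IsLQR : Prop :=
  M.P = M.Q + M.Aᵀ * M.P * M.A
    - M.Aᵀ * M.P * M.B * (M.R + M.Bᵀ * M.P * M.B)⁻¹ * (M.Bᵀ * M.P * M.A) ∧
  M.K = -((M.R + M.Bᵀ * M.P * M.B)⁻¹ * (M.Bᵀ * M.P * M.A))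

/-- The closed-loop state `φ(j; x, κ)`. -/
def closedLoop (κ : (Fin n → ℝ) → (Fin m → ℝ)) (x : Fin n → ℝ) : ℕ → Fin n → ℝ
  | 0 => x
  | j + 1 => M.next (closedLoop κ x j) (κ (closedLoop κ x j))

/-- The law `κ` is admissible from `x`: the constraints hold along the closed-loop evolution. -/
def AdmissibleFrom (κ : (Fin n → ℝ) → (Fin m → ℝ)) (x : Fin n → ℝ) : Prop :=
  ∀ j : ℕ, (M.closedLoop κ x j, κ (M.closedLoop κ x j)) ∈ M.Z

/-- The infinite-horizon cost `V_∞` of the law `κ` from `x` (possibly `∞`). -/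
noncomputable def Vinf (xsp : Fin n → ℝ) (usp : Fin m → ℝ) (κ : (Fin n → ℝ) → (Fin m → ℝ))
    (x : Fin n → ℝ) : ℝ≥0∞ :=
  ∑' j : ℕ, ENNReal.ofReal
    (wsq M.Q (M.closedLoop κ x j - xsp) + wsq M.R (κ (M.closedLoop κ x j) - usp))

/-- `κ` is the constrained infinite-horizon optimal law: from every state from which some law is
admissible, `κ` is admissible and has the least cost among the admissible laws. -/
def IsOptimalLaw (xsp : Fin n → ℝ) (usp : Fin m → ℝ) (κ : (Fin n → ℝ) → (Fin m → ℝ)) : Prop :=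
  ∀ x, (∃ κ', M.AdmissibleFrom κ' x) → M.AdmissibleFrom κ x ∧
    ∀ κ', M.AdmissibleFrom κ' x → M.Vinf xsp usp κ x ≤ M.Vinf xsp usp κ' x

/-- The region `Υ_N(ysp)`: the states, in the domain where the optimal law `κ` is admissible, that
`κ` steers in `N` steps into the terminal set of `(xsp, usp)`. -/
def Upsilon (xsp : Fin n → ℝ) (usp : Fin m → ℝ) (κ : (Fin n → ℝ) → (Fin m → ℝ)) :
    Set (Fin n → ℝ) :=
  {x | M.AdmissibleFrom κ x ∧ (M.closedLoop κ x M.N, xsp, usp) ∈ M.Omega}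

end Design

end MPCT

/-! The offset cost acts as an exact penalty for the constraint `C x_a + D u_a = y_sp`. The feasible
pairs of initial state and decision variables form a polyhedron, and the regulation problem adds
only linear equations. By Hoffman's bound (`hoffmanProperty`, used through `exists_near_of_eq`), a
point feasible for tracking can be moved to one feasible for regulation, over a distance at most a
constant times the offset. The constant depends on neither `x` nor `y_sp`.

For bounded initial states all feasible decisions lie in a fixed ball (`exists_bound_feasible`),
where the quadratic cost is Lipschitz. The move therefore raises the cost by at most `g` times the
offset (`exists_penalty_bound`). A penalty slope strictly above `g`, measured in the given norm,
makes every tracking optimum have zero offset, so values and optimal solutions coincide.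

Uniqueness of the first input comes from the midpoint identity of quadratic costs and observability
(`reg_minimizers_diff`).

For the infinite-horizon law, the Riccati inequality bounds the cost of any infinite trajectory from
below by its `N`-step cost with terminal weight `P` (`lqr_lower_bound`). Conversely, a feasible
`N`-step plan continued by the terminal controller costs no more than its finite-horizon cost, and
becomes a state feedback law once its loops are cut (`exists_law_of_feasible`). The optimal law,
where it reaches the terminal set in time, thus solves the regulation problem. -/

/-! ### Hoffman's error bound by Fourier–Motzkin elimination. -/

/-- The uniform Hoffman bound on `E`: for linear inequalities `f i w ≤ c i`, the distance from `w` to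
a nonempty solution set is at most a multiple of the residual, the factor depending on `f` only. -/
def HoffmanProperty (E : Type*) [NormedAddCommGroup E] [NormedSpace ℝ E] : Prop :=
  ∀ (ι : Type) [Finite ι] (f : ι → (E →ₗ[ℝ] ℝ)), ∃ H : ℝ, 0 ≤ H ∧
    ∀ (c : ι → ℝ) (w₀ : E), (∀ i, f i w₀ ≤ c i) → ∀ (w : E) (r : ℝ), 0 ≤ r →
      (∀ i, f i w ≤ c i + r) → ∃ w', (∀ i, f i w' ≤ c i) ∧ ‖w' - w‖ ≤ H * r

theorem Finite.exists_upper_bound {ι : Type*} [Finite ι] (g : ι → ℝ) :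
    ∃ b : ℝ, 0 ≤ b ∧ ∀ i, g i ≤ b := by
  obtain ⟨b, hb⟩ := Finite.bddAbove_range g
  exact ⟨max b 0, le_max_right _ _, fun i => le_max_of_le_left (hb ⟨i, rfl⟩)⟩

/-- Moving a real number into a nonempty interval given by finitely many bounds that it violates
by at most `s`. -/
theorem exists_between_near {ι κ : Type*} [Finite ι] (lo : ι → ℝ) (up : κ → ℝ) (t s : ℝ)
    (hs : 0 ≤ s) (h : ∀ i j, lo i ≤ up j) (hlo : ∀ i, lo i ≤ t + s) (hup : ∀ j, t - s ≤ up j) :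
    ∃ t', (∀ i, lo i ≤ t') ∧ (∀ j, t' ≤ up j) ∧ |t' - t| ≤ s := by
  -- The new point is the largest of `t - s` and the lower bounds; the extra element `none` carries
  -- `t - s`, so `ι` may be empty.
  obtain ⟨o, ho⟩ := Finite.exists_max (fun o : Option ι => o.elim (t - s) lo)
  have hn : t - s ≤ o.elim (t - s) lo := ho none
  refine ⟨o.elim (t - s) lo, fun i => ho (some i), fun j => ?_, abs_le.2 ⟨by linarith, ?_⟩⟩
  · cases o with
    | none => exact hup j
    | some i => exact h i j
  · cases o with
    | none => simp only [Option.elim]; linarith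
    | some i => have := hlo i; simp only [Option.elim]; linarith

theorem LinearMap.exists_uniform_bound {ι E F : Type*} [Finite ι] [NormedAddCommGroup E]
    [NormedSpace ℝ E] [FiniteDimensional ℝ E] [NormedAddCommGroup F] [NormedSpace ℝ F]
    (f : ι → (E →ₗ[ℝ] F)) : ∃ b : ℝ, 0 ≤ b ∧ ∀ i v, ‖f i v‖ ≤ b * ‖v‖ := by
  obtain ⟨b, hb, h⟩ := Finite.exists_upper_bound fun i => ‖(f i).toContinuousLinearMap‖
  exact ⟨b, hb, fun i v => ((f i).toContinuousLinearMap.le_opNorm v).trans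
    (mul_le_mul_of_nonneg_right (h i) (norm_nonneg v))⟩

/-- Eliminate the real coordinate `t`. A row with positive coefficient bounds `t` above, one with
negative coefficient bounds it below, and `t` exists exactly when each lower bound is at most each
upper bound. These conditions involve `v` alone, so the bound on `E` repairs `v` first; `t` is then
moved into its interval. -/
theorem HoffmanProperty.prod_real {E : Type*} [NormedAddCommGroup E] [NormedSpace ℝ E]
    [FiniteDimensional ℝ E] (hE : HoffmanProperty E) : HoffmanProperty (E × ℝ) := by
  intro ι _ f
  obtain ⟨a, ha⟩ : ∃ a : ι → (E →ₗ[ℝ] ℝ), ∀ i, a i = f i ∘ₗ LinearMap.inl ℝ E ℝ := ⟨_, fun _ => rfl⟩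
  obtain ⟨b, hb⟩ : ∃ b : ι → ℝ, ∀ i, b i = f i (0, 1) := ⟨_, fun _ => rfl⟩
  have hf : ∀ i v t, f i (v, t) = a i v + b i * t := by
    intro i v t
    have : (v, t) = (v, (0 : ℝ)) + t • ((0 : E), (1 : ℝ)) := by simp
    rw [this, map_add, map_smul, ha, hb]
    simp [mul_comm]
  obtain ⟨β, hβ0, hβ⟩ := Finite.exists_upper_bound fun i => |b i|⁻¹
  obtain ⟨L, hL0, hL⟩ := LinearMap.exists_uniform_bound a
  obtain ⟨H, hH0, hH⟩ := hE ({ij : ι × ι // 0 < b ij.1 ∧ b ij.2 < 0} ⊕ {i : ι // b i = 0})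
    (Sum.elim (fun q => (b q.1.1)⁻¹ • a q.1.1 + (-b q.1.2)⁻¹ • a q.1.2) (fun q => a q.1))
  -- A residual `r` becomes at most `2 * β * r` in a combined row and stays `r` in a row without
  -- `t`; `2 * β + 1` covers both.
  set ρ : ℝ := H * (2 * β + 1) with hρ
  have hρ0 : 0 ≤ ρ := by positivity
  refine ⟨ρ + β * (1 + L * ρ), by positivity, ?_⟩
  rintro c ⟨v₀, t₀⟩ h₀ ⟨v, t⟩ r hr hw
  simp only [hf] at h₀ hw
  have hpos : ∀ i, 0 < b i → (b i)⁻¹ ≤ β := fun i hi => by simpa [abs_of_pos hi] using hβ i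
  have hneg : ∀ i, b i < 0 → (-b i)⁻¹ ≤ β := fun i hi => by simpa [abs_of_neg hi] using hβ i
  have up_of : ∀ i, 0 < b i → ∀ (v : E) (t d : ℝ), a i v + b i * t ≤ d →
      t ≤ (b i)⁻¹ * (d - a i v) := fun i hi v t d h => by
    rw [inv_mul_eq_div, le_div_iff₀ hi]; linarith
  have lo_of : ∀ i, b i < 0 → ∀ (v : E) (t d : ℝ), a i v + b i * t ≤ d →
      (-b i)⁻¹ * (a i v - d) ≤ t := fun i hi v t d h => by
    rw [inv_mul_eq_div, div_le_iff₀ (by linarith)]; linarith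
  obtain ⟨v', hv', hvv⟩ := hH
    (Sum.elim (fun q => (b q.1.1)⁻¹ * c q.1.1 + (-b q.1.2)⁻¹ * c q.1.2) (fun q => c q.1)) v₀
    (by
      rintro (⟨⟨i, j⟩, hi, hj⟩ | ⟨i, hi⟩)
      · have h1 := up_of i hi v₀ t₀ _ (h₀ i)
        have h2 := lo_of j hj v₀ t₀ _ (h₀ j)
        simp only [Sum.elim_inl, LinearMap.add_apply, LinearMap.smul_apply, smul_eq_mul]
        linarith
      · have := h₀ i
        rw [hi] at this
        simpa using this) v ((2 * β + 1) * r) (by positivity)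
    (by
      rintro (⟨⟨i, j⟩, hi, hj⟩ | ⟨i, hi⟩)
      · have h1 := up_of i hi v t _ (hw i)
        have h2 := lo_of j hj v t _ (hw j)
        have h3 := mul_le_mul_of_nonneg_right (hpos i hi) hr
        have h4 := mul_le_mul_of_nonneg_right (hneg j hj) hr
        simp only [Sum.elim_inl, LinearMap.add_apply, LinearMap.smul_apply, smul_eq_mul]
        linarith
      · have h1 := hw i
        have h2 : 0 ≤ β * r := by positivity
        rw [hi] at h1
        simp only [Sum.elim_inr]
        linarith)
  have hvv' : ‖v' - v‖ ≤ ρ * r := by rw [hρ]; linarith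
  -- Replacing `v` by `v'` worsens each row by at most `L * ρ * r`, so `t` misses its bounds by at
  -- most `β * (1 + L * ρ) * r`.
  have hs : ∀ i, a i v' ≤ a i v + L * ρ * r ∧ a i v ≤ a i v' + L * ρ * r := fun i => by
    have h1 := (hL i (v' - v)).trans (mul_le_mul_of_nonneg_left hvv' hL0)
    rw [map_sub, Real.norm_eq_abs, abs_le] at h1
    constructor <;> linarith
  have hLr : 0 ≤ (1 + L * ρ) * r := by positivity
  obtain ⟨t', hlo, hup, htt⟩ := exists_between_near
    (fun j : {j // b j < 0} => (-b j.1)⁻¹ * (a j.1 v' - c j.1))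
    (fun i : {i // 0 < b i} => (b i.1)⁻¹ * (c i.1 - a i.1 v')) t (β * ((1 + L * ρ) * r))
    (by positivity)
    (fun j i => by
      have := hv' (Sum.inl ⟨(i.1, j.1), i.2, j.2⟩)
      simp only [Sum.elim_inl, LinearMap.add_apply, LinearMap.smul_apply, smul_eq_mul] at this
      linarith)
    (fun j => by
      have h1 := lo_of j.1 j.2 v' t (c j.1 + (1 + L * ρ) * r) (by
        have := hw j.1; have := (hs j.1).1; linarith)
      have h2 := mul_le_mul_of_nonneg_right (hneg j.1 j.2) hLr
      linarith)
    (fun i => by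
      have h1 := up_of i.1 i.2 v' t (c i.1 + (1 + L * ρ) * r) (by
        have := hw i.1; have := (hs i.1).1; linarith)
      have h2 := mul_le_mul_of_nonneg_right (hpos i.1 i.2) hLr
      linarith)
  refine ⟨(v', t'), fun i => ?_, ?_⟩
  · rw [hf]
    rcases lt_trichotomy (b i) 0 with hi | hi | hi
    · have := hlo ⟨i, hi⟩
      simp only [inv_mul_eq_div] at this
      rw [div_le_iff₀ (by linarith)] at this
      linarith
    · have := hv' (Sum.inr ⟨i, hi⟩)
      simp only [Sum.elim_inr] at this
      rw [hi]; linarith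
    · have := hup ⟨i, hi⟩
      simp only [inv_mul_eq_div] at this
      rw [le_div_iff₀ hi] at this
      linarith
  · rw [Prod.mk_sub_mk, Prod.norm_mk, Real.norm_eq_abs]
    have h1 : 0 ≤ ρ * r := by positivity
    have h2 : 0 ≤ β * ((1 + L * ρ) * r) := by positivity
    exact max_le (by linarith) (by linarith)

theorem HoffmanProperty.congr {E F : Type*} [NormedAddCommGroup E] [NormedSpace ℝ E]
    [NormedAddCommGroup F] [NormedSpace ℝ F] (hE : HoffmanProperty E) (e : E ≃L[ℝ] F) :
    HoffmanProperty F := by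
  intro ι _ f
  obtain ⟨H, hH0, hH⟩ := hE ι fun i => f i ∘ₗ (e : E →ₗ[ℝ] F)
  refine ⟨‖(e : E →L[ℝ] F)‖ * H, by positivity, fun c w₀ h₀ w r hr hw => ?_⟩
  obtain ⟨w', hw', hd⟩ := hH c (e.symm w₀) (by simpa using h₀) (e.symm w) r hr (by simpa using hw)
  refine ⟨e w', by simpa using hw', ?_⟩
  have h1 := (e : E →L[ℝ] F).le_opNorm (w' - e.symm w)
  simp only [ContinuousLinearEquiv.coe_coe, map_sub, ContinuousLinearEquiv.apply_symm_apply] at h1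
  rw [mul_assoc]
  exact h1.trans (mul_le_mul_of_nonneg_left hd (norm_nonneg _))

theorem hoffmanProperty_pi : ∀ d : ℕ, HoffmanProperty (Fin d → ℝ)
  | 0 => fun _ _ _ => ⟨0, le_rfl, fun _ w₀ h₀ w _ _ _ =>
      ⟨w₀, h₀, by rw [Subsingleton.elim w₀ w]; simp⟩⟩
  | d + 1 => ((hoffmanProperty_pi d).prod_real).congr
      (LinearEquiv.ofFinrankEq _ _ (by simp)).toContinuousLinearEquiv

/-- Hoffman's error bound for systems of linear inequalities. -/
theorem hoffmanProperty (E : Type*) [NormedAddCommGroup E] [NormedSpace ℝ E]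
    [FiniteDimensional ℝ E] : HoffmanProperty E :=
  (hoffmanProperty_pi (Module.finrank ℝ E)).congr
    (LinearEquiv.ofFinrankEq _ _ (by simp)).toContinuousLinearEquiv

/-! ### Polyhedra and their slices. -/

namespace MPCT

namespace IsPolyhedron

variable {E F : Type*} [AddCommGroup E] [Module ℝ E] [AddCommGroup F] [Module ℝ F]

theorem of_finite {ι : Type*} [Finite ι] (f : ι → (E →ₗ[ℝ] ℝ)) (c : ι → ℝ) :
    IsPolyhedron {z | ∀ i, f i z ≤ c i} := by
  obtain ⟨k, ⟨e⟩⟩ := Finite.exists_equiv_fin ι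
  refine ⟨k, f ∘ e.symm, c ∘ e.symm, Set.ext fun z => ?_⟩
  exact ⟨fun h i => h _, fun h i => by simpa using h (e i)⟩

theorem preimage {s : Set F} (hs : IsPolyhedron s) (g : E →ₗ[ℝ] F) : IsPolyhedron (g ⁻¹' s) := by
  obtain ⟨k, f, c, rfl⟩ := hs
  exact ⟨k, fun i => f i ∘ₗ g, c, rfl⟩

theorem iInter {ι : Type*} [Finite ι] {s : ι → Set E} (hs : ∀ i, IsPolyhedron (s i)) :
    IsPolyhedron (⋂ i, s i) := by
  choose k f c h using hs
  convert of_finite (fun q : Σ i, Fin (k i) => f q.1 q.2) (fun q => c q.1 q.2)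
  ext z
  simp [h, Sigma.forall]

theorem inter {s t : Set E} (hs : IsPolyhedron s) (ht : IsPolyhedron t) : IsPolyhedron (s ∩ t) := by
  rw [Set.inter_eq_iInter]
  exact iInter fun b => by cases b <;> assumption

theorem convex {s : Set E} (hs : IsPolyhedron s) : Convex ℝ s := by
  obtain ⟨k, f, c, rfl⟩ := hs
  rw [Set.ofPred_forall]
  exact convex_iInter fun i => convex_halfSpace_le (f i).isLinear _

theorem isClosed {E : Type*} [NormedAddCommGroup E] [NormedSpace ℝ E] [FiniteDimensional ℝ E]
    {s : Set E} (hs : IsPolyhedron s) : IsClosed s := by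
  obtain ⟨k, f, c, rfl⟩ := hs
  rw [Set.ofPred_forall]
  exact isClosed_iInter fun i =>
    isClosed_le (f i).continuous_of_finiteDimensional continuous_const

/-- Points of a slice of a polyhedron can be moved into a nonempty subset given by further linear
equations, at a cost proportional to the defect in these equations. -/
theorem exists_near_of_eq {E T : Type*} {p : ℕ} [NormedAddCommGroup E] [NormedSpace ℝ E]
    [FiniteDimensional ℝ E] [AddCommGroup T] [Module ℝ T] {s : Set (T × E)} (hs : IsPolyhedron s)
    (g : E →ₗ[ℝ] (Fin p → ℝ)) :
    ∃ H : ℝ, 0 ≤ H ∧ ∀ (x : T) (y : Fin p → ℝ), (∃ w₀, (x, w₀) ∈ s ∧ g w₀ = y) →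
      ∀ w, (x, w) ∈ s → ∃ w', (x, w') ∈ s ∧ g w' = y ∧ ‖w' - w‖ ≤ H * ‖g w - y‖ := by
  obtain ⟨k, f, c, rfl⟩ := hs
  have hf : ∀ i x w, f i (x, w) = f i (x, 0) + f i (0, w) := fun i x w => by
    rw [← map_add]; simp
  -- Each equation is a pair of inequalities. Both `x` and `y` enter only the right-hand sides, so
  -- `H` does not depend on them.
  obtain ⟨H, hH0, hH⟩ := hoffmanProperty E (Fin k ⊕ (Fin p ⊕ Fin p))
    (Sum.elim (fun i => f i ∘ₗ LinearMap.inr ℝ T E) (Sum.elim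
      (fun l => LinearMap.proj l ∘ₗ g) (fun l => -(LinearMap.proj l ∘ₗ g))))
  refine ⟨H, hH0, ?_⟩
  rintro x y ⟨w₀, hw₀, rfl⟩ w hw
  obtain ⟨w', hw', hd⟩ := hH (Sum.elim (fun i => c i - f i (x, 0)) (Sum.elim (g w₀) (-g w₀))) w₀
    (by
      rintro (i | l | l)
      · have := hw₀ i
        rw [hf] at this
        simp only [Sum.elim_inl, LinearMap.comp_apply, LinearMap.inr_apply]
        linarith
      · simp
      · simp)
    w ‖g w - g w₀‖ (norm_nonneg _)
    (by
      have hl : ∀ l, |g w l - g w₀ l| ≤ ‖g w - g w₀‖ := fun l => norm_le_pi_norm (g w - g w₀) l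
      rintro (i | l | l)
      · have := hw i
        have := norm_nonneg (g w - g w₀)
        rw [hf] at *
        simp only [Sum.elim_inl, LinearMap.comp_apply, LinearMap.inr_apply]
        linarith
      · have := (abs_le.1 (hl l)).2
        simp; linarith
      · have := (abs_le.1 (hl l)).1
        simp; linarith)
  refine ⟨w', fun i => ?_, funext fun l => le_antisymm ?_ ?_, hd⟩
  · have := hw' (Sum.inl i)
    simp only [Sum.elim_inl, LinearMap.comp_apply, LinearMap.inr_apply] at this
    rw [hf]; linarith
  · simpa using hw' (Sum.inr (Sum.inl l))
  · simpa using hw' (Sum.inr (Sum.inr l))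

end IsPolyhedron

end MPCT

/-! ### Quadratic forms and linearity of the predictions. -/

namespace MPCT

section wsq

variable {k l : ℕ} {W : Matrix (Fin k) (Fin k) ℝ}

theorem wsq_nonneg (hW : W.PosSemidef) (v : Fin k → ℝ) : 0 ≤ wsq W v := by
  simpa [wsq] using hW.dotProduct_mulVec_nonneg v

theorem wsq_eq_zero (hW : W.PosDef) {v : Fin k → ℝ} (h : wsq W v ≤ 0) : v = 0 := by
  by_contra hv
  have := hW.dotProduct_mulVec_pos hv
  simp only [star_trivial] at this
  exact absurd h (not_le.2 this)

theorem wsq_zero : wsq W 0 = 0 := by simp [wsq]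

theorem wsq_add_matrix (V W : Matrix (Fin k) (Fin k) ℝ) (v : Fin k → ℝ) :
    wsq (V + W) v = wsq V v + wsq W v := by
  simp [wsq, Matrix.add_mulVec, dotProduct_add]

theorem wsq_sub_matrix (V W : Matrix (Fin k) (Fin k) ℝ) (v : Fin k → ℝ) :
    wsq (V - W) v = wsq V v - wsq W v := by
  simp [wsq, Matrix.sub_mulVec, dotProduct_sub]

theorem wsq_conj (F : Matrix (Fin l) (Fin k) ℝ) (V : Matrix (Fin l) (Fin l) ℝ) (v : Fin k → ℝ) :
    wsq (Fᵀ * V * F) v = wsq V (F *ᵥ v) := by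
  simp only [wsq, ← Matrix.mulVec_mulVec]
  rw [Matrix.dotProduct_mulVec, Matrix.vecMul_transpose]

theorem wsq_mul_self {H : Matrix (Fin k) (Fin k) ℝ} (hH : H.PosSemidef) (v : Fin k → ℝ) :
    wsq (H * H) v = (H *ᵥ v) ⬝ᵥ (H *ᵥ v) := by
  have hT : Hᵀ = H := by simpa using hH.isHermitian.eq
  have := wsq_conj H 1 v
  rw [hT, Matrix.mul_one] at this
  rw [this, wsq, Matrix.one_mulVec]

/-- The midpoint identity of a quadratic form. -/
theorem wsq_midpoint (W : Matrix (Fin k) (Fin k) ℝ) (v w : Fin k → ℝ) :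
    wsq W ((2⁻¹ : ℝ) • v + (2⁻¹ : ℝ) • w)
      = 2⁻¹ * wsq W v + 2⁻¹ * wsq W w - 4⁻¹ * wsq W (v - w) := by
  simp only [wsq, Matrix.mulVec_add, Matrix.mulVec_sub, Matrix.mulVec_smul, dotProduct_add,
    add_dotProduct, dotProduct_sub, sub_dotProduct, dotProduct_smul, smul_dotProduct, smul_eq_mul]
  ring

theorem wsq_add_of_isHermitian (hW : W.IsHermitian) (v w : Fin k → ℝ) :
    wsq W (v + w) = wsq W v + 2 * (v ⬝ᵥ (W *ᵥ w)) + wsq W w := by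
  have hT : Wᵀ = W := by simpa using hW.eq
  have : w ⬝ᵥ (W *ᵥ v) = v ⬝ᵥ (W *ᵥ w) := by
    rw [Matrix.dotProduct_mulVec, ← Matrix.mulVec_transpose, hT, dotProduct_comm]
  simp only [wsq, Matrix.mulVec_add, dotProduct_add, add_dotProduct, this]
  ring

theorem contDiff_wsq (W : Matrix (Fin k) (Fin k) ℝ) : ContDiff ℝ 1 (wsq W) := by
  unfold wsq Matrix.mulVec dotProduct
  fun_prop

end wsq

theorem exists_norm_mulVec_le {k l : ℕ} (A : Matrix (Fin k) (Fin l) ℝ) :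
    ∃ b : ℝ, 0 ≤ b ∧ ∀ v, ‖A *ᵥ v‖ ≤ b * ‖v‖ := by
  obtain ⟨b, hb, h⟩ := LinearMap.exists_uniform_bound fun _ : Unit => A.mulVecLin
  exact ⟨b, hb, h ()⟩

namespace Design

variable {n m p : ℕ} {M : Design n m p}

theorem next_sub (x x' : Fin n → ℝ) (u u' : Fin m → ℝ) :
    M.next (x - x') (u - u') = M.next x u - M.next x' u' := by
  simp only [next, Matrix.mulVec_sub]; abel

theorem next_comb (a b : ℝ) (x x' : Fin n → ℝ) (u u' : Fin m → ℝ) :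
    M.next (a • x + b • x') (a • u + b • u') = a • M.next x u + b • M.next x' u' := by
  simp only [next, Matrix.mulVec_add, Matrix.mulVec_smul, smul_add]; abel

theorem out_comb (a b : ℝ) (x x' : Fin n → ℝ) (u u' : Fin m → ℝ) :
    M.out (a • x + b • x') (a • u + b • u') = a • M.out x u + b • M.out x' u' := by
  simp only [out, Matrix.mulVec_add, Matrix.mulVec_smul, smul_add]; abel

theorem traj_comb (a b : ℝ) (x x' : Fin n → ℝ) (u u' : ℕ → Fin m → ℝ) (j : ℕ) :
    M.traj (a • x + b • x') (a • u + b • u') j = a • M.traj x u j + b • M.traj x' u' j := by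
  induction j with
  | zero => rfl
  | succ j ih => rw [traj, ih, Pi.add_apply, Pi.smul_apply, Pi.smul_apply, next_comb]; rfl

theorem traj_congr (x : Fin n → ℝ) {u u' : ℕ → Fin m → ℝ} {N : ℕ} (h : ∀ j < N, u j = u' j) :
    ∀ j ≤ N, M.traj x u j = M.traj x u' j
  | 0, _ => rfl
  | j + 1, hj => by
    rw [traj, traj, traj_congr x h j (by omega), h j (by omega)]

theorem TrackFeasible.congr {x : Fin n → ℝ} {u u' : ℕ → Fin m → ℝ} {xa : Fin n → ℝ}
    {ua : Fin m → ℝ} (h : ∀ j < M.N, u j = u' j) (hf : M.TrackFeasible x u xa ua) :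
    M.TrackFeasible x u' xa ua := by
  have ht := traj_congr (M := M) x h
  refine ⟨fun j hj => ?_, ?_⟩
  · rw [← ht j hj.le, ← h j hj]; exact hf.1 j hj
  · rw [← ht _ le_rfl]; exact hf.2

theorem regCost_congr (x : Fin n → ℝ) {u u' : ℕ → Fin m → ℝ} (xa : Fin n → ℝ)
    (ua : Fin m → ℝ) (h : ∀ j < M.N, u j = u' j) : M.regCost x u xa ua = M.regCost x u' xa ua := by
  have ht := traj_congr (M := M) x h
  unfold regCost
  rw [ht _ le_rfl]
  congr 1
  refine Finset.sum_congr rfl fun j hj => ?_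
  rw [Finset.mem_range] at hj
  rw [ht j hj.le, h j hj]

/-! ### Lyapunov decrease, observability and bounds on feasible points. -/

namespace Standing

variable (hM : M.Standing)
include hM

theorem Zsp_subset : M.Zsp ⊆ M.Z := by
  rintro z ⟨-, w, hw, rfl⟩
  exact hM.polyhedron.convex.smul_mem_of_zero_mem hM.zero_mem hw ⟨hM.lam_nonneg, hM.lam_lt_one.le⟩

theorem lyapunov_le (e : Fin n → ℝ) :
    wsq M.Q e + wsq M.R (M.K *ᵥ e) + wsq M.P ((M.A + M.B * M.K) *ᵥ e) ≤ wsq M.P e := by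
  have h := wsq_nonneg hM.lyapunov e
  have h0 : -(M.Q + M.Kᵀ * M.R * M.K)
      - ((M.A + M.B * M.K)ᵀ * M.P * (M.A + M.B * M.K) - M.P)
      = M.P - ((M.A + M.B * M.K)ᵀ * M.P * (M.A + M.B * M.K)) - (M.Q + M.Kᵀ * M.R * M.K) := by
    abel
  rw [h0, wsq_sub_matrix, wsq_sub_matrix, wsq_add_matrix, wsq_conj, wsq_conj] at h
  linarith

/-- A state is zero if it is unobservable through the stage cost. -/
theorem eq_zero_of_wsq {e : Fin n → ℝ} (h : ∀ k : ℕ, wsq M.Q (M.A ^ k *ᵥ e) ≤ 0) : e = 0 := by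
  obtain ⟨H, hH, hHQ, hobs⟩ := hM.observable
  refine hobs e fun k => ?_
  have := h k
  rw [← hHQ, wsq_mul_self hH] at this
  exact dotProduct_self_eq_zero.1 (le_antisymm this (by
    simpa using dotProduct_star_self_nonneg (H *ᵥ (M.A ^ k *ᵥ e))))

/-- The Lyapunov inequality telescopes: the terminal cost pays for any number of steps under the
terminal gain. -/
theorem wsq_P_pow_le (e : Fin n → ℝ) (k : ℕ) :
    (∑ j ∈ Finset.range k, (wsq M.Q ((M.A + M.B * M.K) ^ j *ᵥ e)
      + wsq M.R (M.K *ᵥ ((M.A + M.B * M.K) ^ j *ᵥ e)))) + wsq M.P ((M.A + M.B * M.K) ^ k *ᵥ e)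
      ≤ wsq M.P e := by
  induction k with
  | zero => simp
  | succ k ih =>
    have := hM.lyapunov_le ((M.A + M.B * M.K) ^ k *ᵥ e)
    rw [Finset.sum_range_succ, pow_succ', ← Matrix.mulVec_mulVec]
    linarith

/-- The closed loop with the terminal gain has no nonzero periodic point. -/
theorem eq_zero_of_periodic {e : Fin n → ℝ} {k : ℕ} (hk : 0 < k)
    (h : (M.A + M.B * M.K) ^ k *ᵥ e = e) : e = 0 := by
  set F := M.A + M.B * M.K with hF
  have hQ := wsq_nonneg hM.Q_posSemidef
  have hR := wsq_nonneg hM.R_posDef.posSemidef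
  have hmul : ∀ i, F ^ (k * i) *ᵥ e = e := fun i => by
    induction i with
    | zero => simp
    | succ i ih => rw [Nat.mul_succ, pow_add, ← Matrix.mulVec_mulVec, h, ih]
  -- After `k * (j + 1)` steps the orbit is back at `e`, the two `P`-terms cancel, and all stage
  -- costs in between must vanish.
  have hz : ∀ j, wsq M.Q (F ^ j *ᵥ e) + wsq M.R (M.K *ᵥ (F ^ j *ᵥ e)) ≤ 0 := fun j => by
    have h1 := hM.wsq_P_pow_le e (k * (j + 1))
    rw [← hF, hmul] at h1
    have h2 := Finset.single_le_sum (s := Finset.range (k * (j + 1)))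
      (f := fun j => wsq M.Q (F ^ j *ᵥ e) + wsq M.R (M.K *ᵥ (F ^ j *ᵥ e)))
      (fun i _ => add_nonneg (hQ _) (hR _))
      (Finset.mem_range.2 (show j < k * (j + 1) by nlinarith))
    linarith
  -- Vanishing input cost makes the feedback inactive, so the orbit is that of `A` and observability
  -- applies.
  have hA : ∀ j, F ^ j *ᵥ e = M.A ^ j *ᵥ e := fun j => by
    induction j with
    | zero => simp
    | succ j ih =>
      have hK : M.K *ᵥ (F ^ j *ᵥ e) = 0 :=
        wsq_eq_zero hM.R_posDef (by have := hz j; have := hQ (F ^ j *ᵥ e); linarith)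
      rw [pow_succ', pow_succ', ← Matrix.mulVec_mulVec, ← Matrix.mulVec_mulVec, ← ih, hF,
        Matrix.add_mulVec, ← hF, ← Matrix.mulVec_mulVec, hK]
      simp
  refine hM.eq_zero_of_wsq fun j => ?_
  rw [← hA]
  have := hz j; have := hR (M.K *ᵥ (F ^ j *ᵥ e)); linarith

theorem exists_bound_u : ∃ ρ : ℝ, 0 ≤ ρ ∧ ∀ z ∈ M.Z, ‖z.2‖ ≤ ρ := by
  obtain ⟨ρ, hρ⟩ := hM.input_compact.isBounded.exists_norm_le
  exact ⟨max ρ 0, le_max_right _ _, fun z hz => le_max_of_le_left (hρ _ ⟨z, hz, rfl⟩)⟩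

/-- Feasible points are uniformly bounded for bounded initial states. -/
theorem exists_bound_feasible (r : ℝ) : ∃ ρ : ℝ, 0 ≤ ρ ∧ ∀ x u xa ua, ‖x‖ ≤ r →
    M.TrackFeasible x u xa ua → (∀ j < M.N, ‖u j‖ ≤ ρ) ∧ ‖xa‖ ≤ ρ ∧ ‖ua‖ ≤ ρ := by
  obtain ⟨ρ, hρ0, hρ⟩ := hM.exists_bound_u
  obtain ⟨a, ha0, ha⟩ := exists_norm_mulVec_le M.A
  obtain ⟨b, hb0, hb⟩ := exists_norm_mulVec_le M.B
  obtain ⟨κ, hκ0, hκ⟩ := exists_norm_mulVec_le M.K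
  have htraj : ∀ j ≤ M.N, ∃ c : ℝ, ∀ x u xa ua, ‖x‖ ≤ r → M.TrackFeasible x u xa ua →
      ‖M.traj x u j‖ ≤ c := by
    intro j
    induction j with
    | zero => exact fun _ => ⟨r, fun x u xa ua hx _ => hx⟩
    | succ j ih =>
      intro hj
      obtain ⟨c, hc⟩ := ih (by omega)
      refine ⟨a * c + b * ρ, fun x u xa ua hx hf => ?_⟩
      have h1 := hc x u xa ua hx hf
      have h2 := hρ _ (hf.1 j hj)
      exact (norm_add_le _ _).trans (add_le_add
        ((ha _).trans (mul_le_mul_of_nonneg_left h1 ha0))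
        ((hb _).trans (mul_le_mul_of_nonneg_left h2 hb0)))
  obtain ⟨c, hc⟩ := htraj M.N le_rfl
  -- A kernel vector of `1 - (A + B K)` is a point of period one, hence zero; injectivity bounds
  -- `x_a` by its image.
  obtain ⟨Λ, -, hΛ⟩ := (1 - (M.A + M.B * M.K)).mulVecLin.exists_antilipschitzWith (by
    refine LinearMap.ker_eq_bot'.2 fun e he => hM.eq_zero_of_periodic one_pos ?_
    rw [Matrix.mulVecLin_apply, Matrix.sub_mulVec, Matrix.one_mulVec, sub_eq_zero] at he
    rw [pow_one]; exact he.symm)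
  have hΛ' : ∀ e, ‖e‖ ≤ Λ * ‖(1 - (M.A + M.B * M.K)) *ᵥ e‖ := fun e => by
    simpa only [map_zero, dist_zero_right, Matrix.mulVecLin_apply] using hΛ.le_mul_dist e 0
  refine ⟨max ρ (Λ * (b * (ρ + κ * c))), le_max_of_le_left hρ0, fun x u xa ua hx hf =>
    ⟨fun j hj => le_max_of_le_left (hρ _ (hf.1 j hj)), le_max_of_le_right ?_, le_max_of_le_left ?_⟩⟩
  · obtain ⟨h1, h2, -⟩ := hM.Omega_invariant _ _ _ hf.2
    -- The equilibrium equation expresses the image of `x_a` through the admissible terminal input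
    -- and `K x(N)`, both bounded. This bounds `x_a` even if `Z` is unbounded in the state
    -- directions.
    have h3 : (1 - (M.A + M.B * M.K)) *ᵥ xa
        = M.B *ᵥ (M.K *ᵥ (M.traj x u M.N - xa) + ua - M.K *ᵥ M.traj x u M.N) := by
      have h4 : xa = M.A *ᵥ xa + M.B *ᵥ ua := h2.1
      rw [Matrix.sub_mulVec, Matrix.one_mulVec]
      nth_rewrite 1 [h4]
      simp only [Matrix.add_mulVec, Matrix.mulVec_sub, Matrix.mulVec_add, Matrix.mulVec_mulVec]
      abel
    refine (hΛ' xa).trans (mul_le_mul_of_nonneg_left ?_ Λ.2)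
    rw [h3]
    refine (hb _).trans (mul_le_mul_of_nonneg_left ((norm_sub_le _ _).trans
      (add_le_add (hρ _ h1) ?_)) hb0)
    exact (hκ _).trans (mul_le_mul_of_nonneg_left (hc x u xa ua hx hf) hκ0)
  · exact hρ _ (hM.Zsp_subset (hM.Omega_invariant _ _ _ hf.2).2.1)

end Standing
end Design
end MPCT

/-! ### Existence of minimizers and the exact penalty. -/

namespace MPCT

/-- Equivalence of norms: convexity makes `q` continuous, and its minimum on the compact unit sphere
is positive. The sphere is empty if `p = 0`. -/
theorem exists_norm_le_seminorm {p : ℕ} (q : Seminorm ℝ (Fin p → ℝ)) (hq : ∀ y, q y = 0 → y = 0) :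
    ∃ b : ℝ, 0 ≤ b ∧ ∀ y, ‖y‖ ≤ b * q y := by
  have hc : Continuous q :=
    continuousOn_univ.1 (ConvexOn.continuousOn isOpen_univ q.convexOn)
  rcases (Metric.sphere (0 : Fin p → ℝ) 1).eq_empty_or_nonempty with he | hne
  · refine ⟨0, le_rfl, fun y => ?_⟩
    by_contra h
    have hy : ‖y‖ ≠ 0 := fun h0 => h (by simp [h0])
    have : ‖y‖⁻¹ • y ∈ Metric.sphere (0 : Fin p → ℝ) 1 := by
      simp [norm_smul, inv_mul_cancel₀ hy]
    rw [he] at this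
    exact this
  · obtain ⟨y₀, hy₀, hmin⟩ := (isCompact_sphere (0 : Fin p → ℝ) 1).exists_isMinOn hne
      hc.continuousOn
    have hpos : 0 < q y₀ := (apply_nonneg q y₀).lt_of_ne' fun h => by
      rw [hq _ h] at hy₀; simp at hy₀
    refine ⟨(q y₀)⁻¹, (inv_pos.2 hpos).le, fun y => ?_⟩
    rw [inv_mul_eq_div, le_div_iff₀ hpos]
    rcases eq_or_ne y 0 with rfl | hy
    · simp
    have hy' : 0 < ‖y‖ := norm_pos_iff.2 hy
    have h1 : q y₀ ≤ q (‖y‖⁻¹ • y) := hmin (by simp [norm_smul, inv_mul_cancel₀ hy'.ne'])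
    rw [map_smul_eq_mul, norm_inv, norm_norm, inv_mul_eq_div, le_div_iff₀ hy'] at h1
    linarith

namespace Design

variable {n m p : ℕ} (M : Design n m p)

/-- The finite-dimensional space of the decision variables `(u, x_a, u_a)`. -/
abbrev Dec : Type := (Fin M.N → Fin m → ℝ) × (Fin n → ℝ) × (Fin m → ℝ)

/-- Extension of a finite input sequence by zero. -/
def extend : (Fin M.N → Fin m → ℝ) →ₗ[ℝ] (ℕ → Fin m → ℝ) :=
  LinearMap.pi fun j => if h : j < M.N then LinearMap.proj ⟨j, h⟩ else 0

/-- The predicted state as a linear function of initial state and decision variables. -/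
def trajLin (j : ℕ) : ((Fin n → ℝ) × M.Dec) →ₗ[ℝ] (Fin n → ℝ) where
  toFun q := M.traj q.1 (M.extend q.2.1) j
  map_add' q q' := by
    have := traj_comb (M := M) 1 1 q.1 q'.1 (M.extend q.2.1) (M.extend q'.2.1) j
    simpa using this
  map_smul' a q := by
    have := traj_comb (M := M) a 0 q.1 q.1 (M.extend q.2.1) (M.extend q.2.1) j
    simpa using this

/-- The artificial output as a linear function of the decision variables. -/
def outLin : M.Dec →ₗ[ℝ] (Fin p → ℝ) where
  toFun w := M.out w.2.1 w.2.2
  map_add' w w' := by simpa using out_comb (M := M) 1 1 w.2.1 w'.2.1 w.2.2 w'.2.2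
  map_smul' a w := by simpa using out_comb (M := M) a 0 w.2.1 w.2.1 w.2.2 w.2.2

/-- The pairs of an initial state and a feasible point of the MPC for tracking. -/
def feasibleSet : Set ((Fin n → ℝ) × M.Dec) :=
  {q | M.TrackFeasible q.1 (M.extend q.2.1) q.2.2.1 q.2.2.2}

/-- The tracking cost as a function of initial state and decision variables. -/
noncomputable def costFun (q : (Fin n → ℝ) × M.Dec) : ℝ :=
  M.regCost q.1 (M.extend q.2.1) q.2.2.1 q.2.2.2

variable {M}

theorem extend_apply (v : Fin M.N → Fin m → ℝ) (j : Fin M.N) : M.extend v j = v j := by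
  simp [extend]

theorem extend_restrict (u : ℕ → Fin m → ℝ) :
    ∀ j < M.N, u j = M.extend (fun i : Fin M.N => u i) j :=
  fun j hj => (extend_apply (fun i : Fin M.N => u i) ⟨j, hj⟩).symm

theorem contDiff_costFun : ContDiff ℝ 1 M.costFun := by
  have hlin : ∀ {k : ℕ} (W : Matrix (Fin k) (Fin k) ℝ)
      (g : ((Fin n → ℝ) × M.Dec) →ₗ[ℝ] (Fin k → ℝ)), ContDiff ℝ 1 fun q => wsq W (g q) :=
    fun W g => (contDiff_wsq W).comp g.toContinuousLinearMap.contDiff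
  let xa : ((Fin n → ℝ) × M.Dec) →ₗ[ℝ] (Fin n → ℝ) :=
    LinearMap.fst ℝ _ _ ∘ₗ LinearMap.snd ℝ _ _ ∘ₗ LinearMap.snd ℝ _ _
  let ua : ((Fin n → ℝ) × M.Dec) →ₗ[ℝ] (Fin m → ℝ) :=
    LinearMap.snd ℝ _ _ ∘ₗ LinearMap.snd ℝ _ _ ∘ₗ LinearMap.snd ℝ _ _
  let inp (j : ℕ) : ((Fin n → ℝ) × M.Dec) →ₗ[ℝ] (Fin m → ℝ) :=
    LinearMap.proj j ∘ₗ M.extend ∘ₗ LinearMap.fst ℝ _ _ ∘ₗ LinearMap.snd ℝ _ _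
  exact (ContDiff.sum fun j _ => (hlin M.Q (M.trajLin j - xa)).add (hlin M.R (inp j - ua))).add
    (hlin M.P (M.trajLin M.N - xa))

namespace Standing

variable (hM : M.Standing)
include hM

theorem isPolyhedron_feasibleSet : IsPolyhedron M.feasibleSet := by
  let xa : ((Fin n → ℝ) × M.Dec) →ₗ[ℝ] (Fin n → ℝ) :=
    LinearMap.fst ℝ _ _ ∘ₗ LinearMap.snd ℝ _ _ ∘ₗ LinearMap.snd ℝ _ _
  let ua : ((Fin n → ℝ) × M.Dec) →ₗ[ℝ] (Fin m → ℝ) :=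
    LinearMap.snd ℝ _ _ ∘ₗ LinearMap.snd ℝ _ _ ∘ₗ LinearMap.snd ℝ _ _
  let inp (j : ℕ) : ((Fin n → ℝ) × M.Dec) →ₗ[ℝ] (Fin m → ℝ) :=
    LinearMap.proj j ∘ₗ M.extend ∘ₗ LinearMap.fst ℝ _ _ ∘ₗ LinearMap.snd ℝ _ _
  have h1 : IsPolyhedron (⋂ j : Fin M.N, ((M.trajLin j).prod (inp j)) ⁻¹' M.Z) :=
    IsPolyhedron.iInter fun j => hM.polyhedron.preimage _
  have h2 := hM.Omega_polyhedron.preimage ((M.trajLin M.N).prod (xa.prod ua))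
  convert h1.inter h2 using 1
  ext q
  simp only [feasibleSet, TrackFeasible, Set.mem_inter_iff, Set.mem_iInter, Fin.forall_iff]
  rfl

theorem isBounded_feasible (r : ℝ) : ∃ ρ : ℝ, ∀ x, ‖x‖ ≤ r → ∀ w : M.Dec,
    (x, w) ∈ M.feasibleSet → ‖w‖ ≤ ρ := by
  obtain ⟨ρ, hρ0, hρ⟩ := hM.exists_bound_feasible r
  refine ⟨ρ, fun x hx w hw => ?_⟩
  obtain ⟨h1, h2, h3⟩ := hρ x (M.extend w.1) w.2.1 w.2.2 hx hw
  have h4 : ‖w.1‖ ≤ ρ := (pi_norm_le_iff_of_nonneg hρ0).2 fun j => by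
    have := h1 j j.2
    rwa [extend_apply] at this
  exact max_le h4 (max_le h2 h3)

theorem isCompact_regFeasible (x : Fin n → ℝ) (ysp : Fin p → ℝ) :
    IsCompact {w : M.Dec | (x, w) ∈ M.feasibleSet ∧ M.outLin w = ysp} := by
  have hc : Continuous fun w : M.Dec => (x, w) := by fun_prop
  have hcl : IsClosed {w : M.Dec | (x, w) ∈ M.feasibleSet ∧ M.outLin w = ysp} :=
    (hM.isPolyhedron_feasibleSet.isClosed.preimage hc).inter
      (isClosed_eq M.outLin.continuous_of_finiteDimensional continuous_const)
  obtain ⟨ρ, hρ⟩ := hM.isBounded_feasible ‖x‖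
  exact Metric.isCompact_of_isClosed_isBounded hcl
    (isBounded_iff_forall_norm_le.2 ⟨ρ, fun w hw => hρ x le_rfl w hw.1⟩)

/-- A minimizer of the MPC for regulation exists at every feasible state. -/
theorem exists_reg_minimizer {x : Fin n → ℝ} {ysp : Fin p → ℝ} (hx : x ∈ M.regRegion ysp) :
    ∃ u xa ua, M.RegFeasible x ysp u xa ua ∧ ∀ u' xa' ua', M.RegFeasible x ysp u' xa' ua' →
      M.regCost x u xa ua ≤ M.regCost x u' xa' ua' := by
  have hred : ∀ u xa ua, M.RegFeasible x ysp u xa ua → (((fun i : Fin M.N => u i), xa, ua) : M.Dec)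
      ∈ {w : M.Dec | (x, w) ∈ M.feasibleSet ∧ M.outLin w = ysp} :=
    fun u xa ua h => ⟨h.1.congr (extend_restrict u), h.2⟩
  have hc : Continuous fun w : M.Dec => M.costFun (x, w) :=
    contDiff_costFun.continuous.comp (by fun_prop)
  obtain ⟨u, xa, ua, h⟩ := hx
  obtain ⟨w, hw, hmin⟩ := (hM.isCompact_regFeasible x ysp).exists_isMinOn
    ⟨_, hred u xa ua h⟩ hc.continuousOn
  refine ⟨M.extend w.1, w.2.1, w.2.2, hw, fun u' xa' ua' h' => ?_⟩
  exact (isMinOn_iff.1 hmin _ (hred u' xa' ua' h')).trans_eq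
    (regCost_congr x xa' ua' (extend_restrict u')).symm

/-- Exactness of the penalty: a feasible point of the MPC for tracking is beaten by one of the MPC
for regulation up to a multiple of the offset. -/
theorem exists_penalty_bound {S : Set ((Fin n → ℝ) × (Fin p → ℝ))}
    (hS : Bornology.IsBounded M.Z ∨ Bornology.IsBounded S) :
    ∃ g : ℝ, 0 ≤ g ∧ ∀ x ysp, x ∈ M.regRegion ysp → (x, ysp) ∈ S → ∀ u xa ua,
      M.TrackFeasible x u xa ua → ∃ u' xa' ua', M.RegFeasible x ysp u' xa' ua' ∧
        M.regCost x u' xa' ua' ≤ M.regCost x u xa ua + g * ‖M.out xa ua - ysp‖ := by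
  -- If `Z` is bounded, the constraint at time `0`, present because `N ≥ 1`, bounds `x`.
  obtain ⟨r, hr⟩ : ∃ r, ∀ x ysp, x ∈ M.regRegion ysp → (x, ysp) ∈ S → ‖x‖ ≤ r := by
    rcases hS with h | h
    · obtain ⟨r, hr⟩ := h.exists_norm_le
      refine ⟨r, fun x ysp hx _ => ?_⟩
      obtain ⟨u, xa, ua, hf, -⟩ := hx
      exact (le_max_left _ _).trans (hr _ (hf.1 0 hM.horizon))
    · obtain ⟨r, hr⟩ := h.exists_norm_le
      exact ⟨r, fun x ysp _ hx => (le_max_left _ _).trans (hr _ hx)⟩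
  obtain ⟨ρ, hρ⟩ := hM.isBounded_feasible r
  obtain ⟨H, hH0, hH⟩ := hM.isPolyhedron_feasibleSet.exists_near_of_eq M.outLin
  -- A quadratic cost is only locally Lipschitz; the a priori bound on feasible decisions confines
  -- both points to one compact ball.
  obtain ⟨Λ, hΛ⟩ := (contDiff_costFun (M := M)).locallyLipschitz.locallyLipschitzOn
    (s := Metric.closedBall 0 (max r ρ)) |>.exists_lipschitzOnWith_of_compact
      (isCompact_closedBall _ _)
  have hmem : ∀ x w, ‖x‖ ≤ r → (x, w) ∈ M.feasibleSet →
      (x, w) ∈ Metric.closedBall (0 : (Fin n → ℝ) × M.Dec) (max r ρ) := by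
    intro x w hx hw
    rw [mem_closedBall_zero_iff]
    exact max_le_max hx (hρ x hx w hw)
  refine ⟨Λ * H, by positivity, fun x ysp hx hxS u xa ua hf => ?_⟩
  have hxr := hr x ysp hx hxS
  obtain ⟨u₀, xa₀, ua₀, h₀⟩ := hx
  obtain ⟨w, hw⟩ : ∃ w : M.Dec, w = ((fun i : Fin M.N => u i), xa, ua) := ⟨_, rfl⟩
  have hwf : (x, w) ∈ M.feasibleSet := hw ▸ hf.congr (extend_restrict u)
  obtain ⟨w', hw'f, hw'o, hd⟩ := hH x ysp
    ⟨((fun i : Fin M.N => u₀ i), xa₀, ua₀), h₀.1.congr (extend_restrict u₀), h₀.2⟩ w hwf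
  refine ⟨M.extend w'.1, w'.2.1, w'.2.2, ⟨hw'f, hw'o⟩, ?_⟩
  have h1 := hΛ.dist_le_mul _ (hmem x w' hxr hw'f) _ (hmem x w hxr hwf)
  have h2 : dist (x, w') (x, w) = ‖w' - w‖ := by
    rw [dist_eq_norm, Prod.mk_sub_mk, sub_self, Prod.norm_mk, norm_zero,
      max_eq_right (norm_nonneg _)]
  rw [h2, Real.dist_eq] at h1
  have h3 : M.costFun (x, w) = M.regCost x u xa ua := by
    rw [hw, regCost_congr x xa ua (extend_restrict u)]; rfl
  have h4 : M.outLin w = M.out xa ua := by rw [hw]; rfl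
  have h5 := (le_abs_self _).trans (h1.trans (mul_le_mul_of_nonneg_left hd Λ.2))
  rw [h3, h4] at h5
  change M.costFun (x, w') ≤ _
  linarith

end Standing

/-! ### Uniqueness of the optimal first input. -/

/-- The value of the midpoint of two feasible points. -/
theorem regCost_midpoint (x : Fin n → ℝ) (u u' : ℕ → Fin m → ℝ) (xa xa' : Fin n → ℝ)
    (ua ua' : Fin m → ℝ) :
    M.regCost x ((2⁻¹ : ℝ) • u + (2⁻¹ : ℝ) • u') ((2⁻¹ : ℝ) • xa + (2⁻¹ : ℝ) • xa')
        ((2⁻¹ : ℝ) • ua + (2⁻¹ : ℝ) • ua')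
      = 2⁻¹ * M.regCost x u xa ua + 2⁻¹ * M.regCost x u' xa' ua'
        - 4⁻¹ * M.regCost 0 (u - u') (xa - xa') (ua - ua') := by
  have hx : x = (2⁻¹ : ℝ) • x + (2⁻¹ : ℝ) • x := by rw [← add_smul]; norm_num
  have ht : ∀ j, M.traj x ((2⁻¹ : ℝ) • u + (2⁻¹ : ℝ) • u') j
      = (2⁻¹ : ℝ) • M.traj x u j + (2⁻¹ : ℝ) • M.traj x u' j := fun j => by
    conv_lhs => rw [hx]
    exact traj_comb _ _ _ _ _ _ _
  have hd : ∀ j, M.traj 0 (u - u') j = M.traj x u j - M.traj x u' j := fun j => by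
    have := traj_comb (M := M) 1 (-1) x x u u' j
    simpa [← sub_eq_add_neg] using this
  have hW : ∀ {k : ℕ} (W : Matrix (Fin k) (Fin k) ℝ) (a a' b b' : Fin k → ℝ),
      wsq W ((2⁻¹ : ℝ) • a + (2⁻¹ : ℝ) • a' - ((2⁻¹ : ℝ) • b + (2⁻¹ : ℝ) • b'))
        = 2⁻¹ * wsq W (a - b) + 2⁻¹ * wsq W (a' - b') - 4⁻¹ * wsq W (a - a' - (b - b')) := by
    intro k W a a' b b'
    have h1 := wsq_midpoint W (a - b) (a' - b')
    have h2 : a - b - (a' - b') = a - a' - (b - b') := by abel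
    rw [h2] at h1
    rw [← h1, smul_sub, smul_sub]
    congr 1
    abel
  simp only [regCost, ht, hd, hW, Pi.add_apply, Pi.smul_apply, Pi.sub_apply, mul_add,
    Finset.mul_sum]
  rw [show ∀ a b c d e f : ℝ, a + b + (c + d) - (e + f) = (a + c - e) + (b + d - f) by
    intros; ring]
  rw [← Finset.sum_add_distrib, ← Finset.sum_sub_distrib]
  congr 1
  exact Finset.sum_congr rfl fun j _ => by ring

namespace Standing

variable (hM : M.Standing)
include hM

theorem regFeasible_midpoint {x : Fin n → ℝ} {ysp : Fin p → ℝ} {u u' : ℕ → Fin m → ℝ}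
    {xa xa' : Fin n → ℝ} {ua ua' : Fin m → ℝ} (h : M.RegFeasible x ysp u xa ua)
    (h' : M.RegFeasible x ysp u' xa' ua') :
    M.RegFeasible x ysp ((2⁻¹ : ℝ) • u + (2⁻¹ : ℝ) • u') ((2⁻¹ : ℝ) • xa + (2⁻¹ : ℝ) • xa')
        ((2⁻¹ : ℝ) • ua + (2⁻¹ : ℝ) • ua') := by
  have hx : x = (2⁻¹ : ℝ) • x + (2⁻¹ : ℝ) • x := by rw [← add_smul]; norm_num
  have ht : ∀ j, M.traj x ((2⁻¹ : ℝ) • u + (2⁻¹ : ℝ) • u') j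
      = (2⁻¹ : ℝ) • M.traj x u j + (2⁻¹ : ℝ) • M.traj x u' j := fun j => by
    conv_lhs => rw [hx]
    exact traj_comb _ _ _ _ _ _ _
  have h2 : (0 : ℝ) ≤ 2⁻¹ := by norm_num
  have h1 : (2⁻¹ : ℝ) + 2⁻¹ = 1 := by norm_num
  refine ⟨⟨fun j hj => ?_, ?_⟩, ?_⟩
  · rw [ht]
    exact hM.polyhedron.convex (h.1.1 j hj) (h'.1.1 j hj) h2 h2 h1
  · rw [ht]
    exact hM.Omega_polyhedron.convex h.1.2 h'.1.2 h2 h2 h1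
  · rw [out_comb, h.2, h'.2, ← add_smul, h1, one_smul]

/-- Two minimizers of the MPC for regulation share the artificial state, and their inputs differ by
a constant in the kernel of `B` and `D`. -/
theorem reg_minimizers_diff {x : Fin n → ℝ} {ysp : Fin p → ℝ} {u u' : ℕ → Fin m → ℝ}
    {xa xa' : Fin n → ℝ} {ua ua' : Fin m → ℝ} (h : M.RegFeasible x ysp u xa ua)
    (h' : M.RegFeasible x ysp u' xa' ua')
    (hmin : ∀ v ya va, M.RegFeasible x ysp v ya va → M.regCost x u xa ua ≤ M.regCost x v ya va)
    (hmin' : ∀ v ya va, M.RegFeasible x ysp v ya va →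
      M.regCost x u' xa' ua' ≤ M.regCost x v ya va) :
    u 0 - u' 0 = ua - ua' ∧ M.B *ᵥ (ua - ua') = 0 ∧ M.D *ᵥ (ua - ua') = 0 := by
  have hQ := wsq_nonneg hM.Q_posSemidef
  have hR := wsq_nonneg hM.R_posDef.posSemidef
  have hP := wsq_nonneg hM.P_posDef.posSemidef
  -- The midpoint is feasible and cannot beat the two minimizers, so the quadratic defect in the
  -- midpoint identity vanishes.
  have hJ : M.regCost 0 (u - u') (xa - xa') (ua - ua') ≤ 0 := by
    have h1 := hmin _ _ _ (hM.regFeasible_midpoint h h')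
    have h2 := hmin' _ _ _ h
    rw [regCost_midpoint] at h1
    linarith
  set v := u - u' with hv
  set ya := xa - xa' with hya
  set va := ua - ua' with hva
  have hterm : ∀ j, 0 ≤ wsq M.Q (M.traj 0 v j - ya) + wsq M.R (v j - va) :=
    fun j => add_nonneg (hQ _) (hR _)
  have hst : ∀ j < M.N, wsq M.Q (M.traj 0 v j - ya) + wsq M.R (v j - va) ≤ 0 := fun j hj => by
    have h1 := Finset.single_le_sum (fun i _ => hterm i) (Finset.mem_range.2 hj)
    have h2 := hP (M.traj 0 v M.N - ya)
    unfold regCost at hJ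
    linarith
  have hend : M.traj 0 v M.N - ya = 0 := wsq_eq_zero hM.P_posDef (by
    have := Finset.sum_nonneg fun j (_ : j ∈ Finset.range M.N) => hterm j
    unfold regCost at hJ
    linarith)
  have hu : ∀ j < M.N, v j - va = 0 := fun j hj => wsq_eq_zero hM.R_posDef (by
    have := hst j hj; have := hQ (M.traj 0 v j - ya); linarith)
  have hya_eq : ya = M.next ya va := by
    have h1 : xa = M.next xa ua := (hM.Omega_invariant _ _ _ h.1.2).2.1.1
    have h2 : xa' = M.next xa' ua' := (hM.Omega_invariant _ _ _ h'.1.2).2.1.1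
    rw [hya, hva, next_sub, ← h1, ← h2]
  -- The difference of inputs is the constant `va` and `ya` is an equilibrium for it, so the
  -- deviation evolves freely under `A`.
  have htr : ∀ j ≤ M.N, M.traj 0 v j - ya = M.A ^ j *ᵥ (-ya) := fun j => by
    induction j with
    | zero => simp [traj]
    | succ j ih =>
      intro hj
      have h1 : v j = va := sub_eq_zero.1 (hu j (by omega))
      rw [traj, h1]
      nth_rewrite 1 [hya_eq]
      rw [← next_sub, ih (by omega), sub_self, next, Matrix.mulVec_zero, add_zero,
        Matrix.mulVec_mulVec, ← pow_succ']
  have hya0 : -ya = 0 := by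
    refine hM.eq_zero_of_wsq fun k => ?_
    rcases lt_or_ge k M.N with hk | hk
    · rw [← htr k hk.le]
      have := hst k hk; have := hR (v k - va); linarith
    · obtain ⟨i, rfl⟩ := Nat.exists_eq_add_of_le' hk
      -- Beyond the horizon the deviation stays zero because `P ≻ 0` annihilates it at time `N`;
      -- hence no relation between `N` and `n` is needed.
      rw [pow_add, ← Matrix.mulVec_mulVec, ← htr _ le_rfl, hend, Matrix.mulVec_zero, wsq_zero]
  rw [neg_eq_zero] at hya0
  have hB : M.B *ᵥ va = 0 := by
    rw [hya0, next, Matrix.mulVec_zero, zero_add] at hya_eq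
    exact hya_eq.symm
  have hD : M.D *ᵥ va = 0 := by
    have h1 : M.C *ᵥ ya + M.D *ᵥ va = 0 := by
      have h2 : M.out xa ua - M.out xa' ua' = 0 := by rw [h.2, h'.2, sub_self]
      rw [← h2, hya, hva]
      simp only [out, Matrix.mulVec_sub]; abel
    rwa [hya0, Matrix.mulVec_zero, zero_add] at h1
  exact ⟨sub_eq_zero.1 (hu 0 hM.horizon), hB, hD⟩

end Standing
end Design
end MPCT

/-! ### Infinite-horizon costs and the optimal feedback law. -/

-- An injective linear map from a finite-dimensional space is a closed embedding. The target may be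
-- infinite-dimensional, as for the observability map with all powers of `A`.
open Filter Topology in
theorem LinearMap.tendsto_zero_of_injective {E F : Type*} [AddCommGroup E] [Module ℝ E]
    [TopologicalSpace E] [IsTopologicalAddGroup E] [ContinuousSMul ℝ E] [T2Space E]
    [FiniteDimensional ℝ E] [AddCommGroup F] [Module ℝ F] [TopologicalSpace F]
    [IsTopologicalAddGroup F] [ContinuousSMul ℝ F] [T2Space F] (f : E →ₗ[ℝ] F)
    (hf : ∀ v, f v = 0 → v = 0) {v : ℕ → E} (h : Tendsto (fun j => f (v j)) atTop (𝓝 0)) :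
    Tendsto v atTop (𝓝 0) := by
  rw [(LinearMap.isClosedEmbedding_of_injective
    (LinearMap.ker_eq_bot'.2 hf)).isInducing.tendsto_nhds_iff, map_zero]
  exact h

open Filter Topology in
theorem tendsto_zero_of_dotProduct_self {k : ℕ} {v : ℕ → Fin k → ℝ}
    (h : Tendsto (fun j => v j ⬝ᵥ v j) atTop (𝓝 0)) : Tendsto v atTop (𝓝 0) := by
  refine tendsto_pi_nhds.2 fun i => ?_
  have h1 : Tendsto (fun j => v j i ^ 2) atTop (𝓝 0) :=
    squeeze_zero (fun j => sq_nonneg _) (fun j => by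
      rw [sq]
      exact Finset.single_le_sum (f := fun i => v j i * v j i)
        (fun i _ => mul_self_nonneg (v j i)) (Finset.mem_univ i)) h
  have h2 := h1.sqrt
  simp only [Real.sqrt_sq_eq_abs, Real.sqrt_zero] at h2
  exact (tendsto_zero_iff_abs_tendsto_zero _).2 h2

namespace MPCT

open scoped MatrixOrder Matrix.Norms.L2Operator in
open Filter Topology in
theorem tendsto_zero_of_wsq {k : ℕ} {W : Matrix (Fin k) (Fin k) ℝ} (hW : W.PosDef)
    {v : ℕ → Fin k → ℝ} (h : Tendsto (fun j => wsq W (v j)) atTop (𝓝 0)) :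
    Tendsto v atTop (𝓝 0) := by
  obtain ⟨L, hL⟩ := CStarAlgebra.nonneg_iff_eq_star_mul_self.1 hW.posSemidef.nonneg
  have hLv : ∀ w, wsq W w = (L *ᵥ w) ⬝ᵥ (L *ᵥ w) := fun w => by
    have := wsq_conj L 1 w
    rw [Matrix.mul_one, wsq, wsq, Matrix.one_mulVec] at this
    rw [hL, Matrix.star_eq_conjTranspose, Matrix.conjTranspose_eq_transpose_of_trivial, wsq, this]
  refine L.mulVecLin.tendsto_zero_of_injective (fun w hw => wsq_eq_zero hW ?_)
    (tendsto_zero_of_dotProduct_self ?_)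
  · rw [hLv, show L *ᵥ w = 0 from hw]; simp
  · simp only [hLv] at h
    exact h

namespace Design

variable {n m p : ℕ} {M : Design n m p}

/-- The optimality inequality of the Riccati equation. -/
theorem IsLQR.wsq_P_le (hL : M.IsLQR) (hM : M.Standing) (e : Fin n → ℝ) (v : Fin m → ℝ) :
    wsq M.P e ≤ wsq M.Q e + wsq M.R v + wsq M.P (M.next e v) := by
  have hG : (M.R + M.Bᵀ * M.P * M.B).PosDef := by
    have := hM.P_posDef.posSemidef.conjTranspose_mul_mul_same M.B
    rw [Matrix.conjTranspose_eq_transpose_of_trivial] at this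
    exact hM.R_posDef.add_posSemidef this
  obtain ⟨G, hGdef⟩ : ∃ G, G = M.R + M.Bᵀ * M.P * M.B := ⟨_, rfl⟩
  obtain ⟨g, hg⟩ : ∃ g, g = (M.Bᵀ * M.P * M.A) *ᵥ e := ⟨_, rfl⟩
  have hPT : M.Pᵀ = M.P := by simpa using hM.P_posDef.isHermitian.eq
  rw [← hGdef] at hG
  have hGinv : G *ᵥ (G⁻¹ *ᵥ g) = g := by
    rw [Matrix.mulVec_mulVec, Matrix.mul_nonsing_inv _ (G.isUnit_iff_isUnit_det.1 hG.isUnit),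
      Matrix.one_mulVec]
  have h1 : wsq M.P e = wsq M.Q e + wsq M.P (M.A *ᵥ e) - g ⬝ᵥ (G⁻¹ *ᵥ g) := by
    conv_lhs => rw [hL.1]
    rw [← hGdef, wsq_sub_matrix, wsq_add_matrix, wsq_conj]
    congr 1
    have h2 : M.Aᵀ * M.P * M.B = (M.Bᵀ * M.P * M.A)ᵀ := by
      simp [Matrix.transpose_mul, hPT, Matrix.mul_assoc]
    rw [wsq, h2, ← Matrix.mulVec_mulVec, ← Matrix.mulVec_mulVec, Matrix.dotProduct_mulVec,
      Matrix.vecMul_transpose, ← hg]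
  have h2 : wsq M.P (M.next e v)
      = wsq M.P (M.A *ᵥ e) + 2 * (v ⬝ᵥ g) + wsq (M.Bᵀ * M.P * M.B) v := by
    have h3 : v ⬝ᵥ g = (M.B *ᵥ v) ⬝ᵥ (M.P *ᵥ (M.A *ᵥ e)) := by
      rw [hg, ← Matrix.mulVec_mulVec, ← Matrix.mulVec_mulVec, Matrix.dotProduct_mulVec,
        Matrix.vecMul_transpose]
    rw [next, add_comm, wsq_add_of_isHermitian hM.P_posDef.isHermitian, wsq_conj, h3]
    ring
  have h3 : wsq G v = wsq M.R v + wsq (M.Bᵀ * M.P * M.B) v := by rw [hGdef, wsq_add_matrix]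
  -- Completion of the square: this is exactly the gap in the inequality, which vanishes at the LQR
  -- input.
  have h4 := wsq_nonneg hG.posSemidef (v + G⁻¹ *ᵥ g)
  rw [wsq_add_of_isHermitian hG.isHermitian, hGinv, wsq, wsq, hGinv,
    dotProduct_comm (G⁻¹ *ᵥ g)] at h4
  rw [wsq] at h3
  linarith

/-- The stage cost with respect to an equilibrium. -/
noncomputable def stage (M : Design n m p) (xsp : Fin n → ℝ) (usp : Fin m → ℝ) (x : Fin n → ℝ)
    (u : Fin m → ℝ) : ℝ :=
  wsq M.Q (x - xsp) + wsq M.R (u - usp)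

namespace Standing

variable (hM : M.Standing)
include hM

theorem stage_nonneg (xsp : Fin n → ℝ) (usp : Fin m → ℝ) (x : Fin n → ℝ) (u : Fin m → ℝ) :
    0 ≤ M.stage xsp usp x u :=
  add_nonneg (wsq_nonneg hM.Q_posSemidef _) (wsq_nonneg hM.R_posDef.posSemidef _)

open Filter Topology in
/-- By observability, a trajectory of finite cost converges to the origin. -/
theorem tendsto_zero_of_cost {e : ℕ → Fin n → ℝ} {v : ℕ → Fin m → ℝ}
    (he : ∀ j, e (j + 1) = M.next (e j) (v j)) {c : ℝ}
    (hc : ∀ J, ∑ j ∈ Finset.range J, (wsq M.Q (e j) + wsq M.R (v j)) ≤ c) :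
    Tendsto e atTop (𝓝 0) := by
  have hQ := wsq_nonneg hM.Q_posSemidef
  have hR := wsq_nonneg hM.R_posDef.posSemidef
  have hl := (summable_of_sum_range_le (fun j => add_nonneg (hQ (e j)) (hR (v j)))
    hc).tendsto_atTop_zero
  have hv : Tendsto v atTop (𝓝 0) := tendsto_zero_of_wsq hM.R_posDef
    (squeeze_zero (fun j => hR _) (fun j => le_add_of_nonneg_left (hQ (e j))) hl)
  obtain ⟨H, hH, hHQ, hobs⟩ := hM.observable
  have hHe : Tendsto (fun j => H *ᵥ e j) atTop (𝓝 0) := tendsto_zero_of_dotProduct_self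
    (squeeze_zero (fun j => by rw [← wsq_mul_self hH, hHQ]; exact hQ _)
      (fun j => by rw [← wsq_mul_self hH, hHQ]; exact le_add_of_nonneg_right (hR (v j))) hl)
  -- Later outputs tend to zero as well; trading a power of `A` for a time shift costs only a term
  -- in the vanishing input.
  have hk : ∀ k, Tendsto (fun j => H *ᵥ (M.A ^ k *ᵥ e j)) atTop (𝓝 0) := fun k => by
    induction k with
    | zero => simpa using hHe
    | succ k ih =>
      have h1 : ∀ j, H *ᵥ (M.A ^ (k + 1) *ᵥ e j)
          = H *ᵥ (M.A ^ k *ᵥ e (j + 1)) - (H * M.A ^ k * M.B) *ᵥ v j := fun j => by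
        rw [he, next, pow_succ, Matrix.mulVec_add, Matrix.mulVec_add]
        simp only [← Matrix.mulVec_mulVec, add_sub_cancel_right]
      simp only [h1]
      have h2 : Tendsto (fun j => (H * M.A ^ k * M.B) *ᵥ v j) atTop (𝓝 0) := by
        have h3 : Continuous fun w => (H * M.A ^ k * M.B) *ᵥ w := by fun_prop
        have h4 := (h3.tendsto 0).comp hv
        rwa [Matrix.mulVec_zero] at h4
      simpa using (ih.comp (tendsto_add_atTop_nat 1)).sub h2
  refine (LinearMap.pi fun k => H.mulVecLin ∘ₗ (M.A ^ k).mulVecLin).tendsto_zero_of_injective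
    (fun w hw => hobs w fun k => congrFun hw k) (tendsto_pi_nhds.2 hk)

open Filter Topology in
/-- With the terminal cost of the LQR, the finite-horizon cost is a lower bound for the cost of an
infinite trajectory. -/
theorem lqr_lower_bound (hL : M.IsLQR) {e : ℕ → Fin n → ℝ} {v : ℕ → Fin m → ℝ}
    (he : ∀ j, e (j + 1) = M.next (e j) (v j)) {c : ℝ}
    (hc : ∀ J, ∑ j ∈ Finset.range J, (wsq M.Q (e j) + wsq M.R (v j)) ≤ c) (N : ℕ) :
    ∑ j ∈ Finset.range N, (wsq M.Q (e j) + wsq M.R (v j)) + wsq M.P (e N) ≤ c := by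
  -- By the Riccati inequality the truncated cost plus terminal cost increases with the horizon, and
  -- its limit is at most `c` since the state tends to zero.
  have hmono : Monotone fun J =>
      ∑ j ∈ Finset.range J, (wsq M.Q (e j) + wsq M.R (v j)) + wsq M.P (e J) :=
    monotone_nat_of_le_succ fun J => by
      have := hL.wsq_P_le hM (e J) (v J)
      rw [← he] at this
      rw [Finset.sum_range_succ]
      linarith
  have hP : Tendsto (fun J => c + wsq M.P (e J)) atTop (𝓝 (c + 0)) := by
    refine tendsto_const_nhds.add ?_
    have := ((contDiff_wsq M.P).continuous.tendsto 0).comp (hM.tendsto_zero_of_cost he hc)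
    rwa [wsq_zero] at this
  rw [add_zero] at hP
  refine ge_of_tendsto hP ((eventually_ge_atTop N).mono fun J hJ => ?_)
  have h1 := hmono hJ
  have h2 := hc J
  simp only at h1
  linarith

/-- An admissible trajectory that visits no state but the equilibrium infinitely often can be
replaced, by cutting its loops, by the closed loop of a feedback law of no larger cost. -/
theorem exists_law_of_sequence {xsp : Fin n → ℝ} {usp : Fin m → ℝ}
    (heq : xsp = M.next xsp usp) (hZ : (xsp, usp) ∈ M.Z) {z : ℕ → Fin n → ℝ} {v : ℕ → Fin m → ℝ}
    (hz : ∀ j, z (j + 1) = M.next (z j) (v j)) (hzv : ∀ j, (z j, v j) ∈ M.Z)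
    (hvis : ∀ s, (∀ J, ∃ j, J ≤ j ∧ z j = s) → s = xsp) {c : ℝ}
    (hc : ∀ J, ∑ j ∈ Finset.range J, M.stage xsp usp (z j) (v j) ≤ c) :
    ∃ κ, M.AdmissibleFrom κ (z 0) ∧ ∀ J, ∑ j ∈ Finset.range J,
      M.stage xsp usp (M.closedLoop κ (z 0) j) (κ (M.closedLoop κ (z 0) j)) ≤ c := by
  -- Every visited state has a last visit, or recurs forever and is then the equilibrium.
  have hlast : ∀ T, (∃ j, T ≤ j ∧ z j = z T ∧ ∀ i, z i = z T → i ≤ j) ∨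
      (¬ (∃ j, z j = z T ∧ ∀ i, z i = z T → i ≤ j) ∧ z T = xsp) := by
    intro T
    by_cases h : ∃ j, z j = z T ∧ ∀ i, z i = z T → i ≤ j
    · obtain ⟨j, hj, hmax⟩ := h
      exact Or.inl ⟨j, hmax T rfl, hj, hmax⟩
    · refine Or.inr ⟨h, hvis _ fun J => ?_⟩
      by_contra! hJ
      have hb : BddAbove {j | z j = z T} :=
        ⟨J, fun j hj => by by_contra hlt; exact hJ j (not_le.1 hlt).le hj⟩
      exact h ⟨sSup {j | z j = z T}, Nat.sSup_mem (s := {j | z j = z T}) ⟨T, rfl⟩ hb, fun i hi => le_csSup hb hi⟩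
  classical
  -- The law uses the input of the last visit and defaults to `usp`, which keeps a recurrent
  -- equilibrium at rest at zero cost.
  obtain ⟨κ, hκ⟩ : ∃ κ : (Fin n → ℝ) → (Fin m → ℝ), ∀ s, κ s =
      if h : ∃ j, z j = s ∧ ∀ i, z i = s → i ≤ j then v h.choose else usp := ⟨_, fun _ => rfl⟩
  have hκ1 : ∀ j, (∀ i, z i = z j → i ≤ j) → κ (z j) = v j := fun j hj => by
    have h : ∃ i, z i = z j ∧ ∀ l, z l = z j → l ≤ i := ⟨j, rfl, hj⟩
    rw [hκ, dif_pos h]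
    congr 1
    exact le_antisymm (hj _ h.choose_spec.1) (h.choose_spec.2 j rfl)
  -- The closed loop only skips ahead along the sequence or rests, so its cost is at most that of
  -- the part passed.
  have hinv : ∀ k, ∃ T, M.closedLoop κ (z 0) k = z T ∧
      ∑ j ∈ Finset.range k, M.stage xsp usp (M.closedLoop κ (z 0) j) (κ (M.closedLoop κ (z 0) j))
        ≤ ∑ j ∈ Finset.range T, M.stage xsp usp (z j) (v j) := by
    intro k
    induction k with
    | zero => exact ⟨0, rfl, le_rfl⟩
    | succ k ih =>
      obtain ⟨T, hT, hle⟩ := ih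
      rcases hlast T with ⟨j, hTj, hj, hmax⟩ | ⟨hno, hx⟩
      · have h1 : κ (z j) = v j := hκ1 j fun i hi => hmax i (hi.trans hj)
        refine ⟨j + 1, by rw [closedLoop, hT, ← hj, h1, hz], ?_⟩
        rw [Finset.sum_range_succ, Finset.sum_range_succ, hT, ← hj, h1]
        have h2 := Finset.sum_le_sum_of_subset_of_nonneg (Finset.range_mono hTj)
          fun i _ _ => hM.stage_nonneg xsp usp (z i) (v i)
        linarith
      · have h1 : κ (z T) = usp := by rw [hκ, dif_neg hno]
        refine ⟨T, by rw [closedLoop, hT, h1, hx, ← heq], ?_⟩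
        rw [Finset.sum_range_succ, hT, h1, hx]
        simpa [stage, wsq_zero] using hle
  refine ⟨κ, fun k => ?_, fun k => ?_⟩
  · obtain ⟨T, hT, -⟩ := hinv k
    rw [hT]
    rcases hlast T with ⟨j, hTj, hj, hmax⟩ | ⟨hno, hx⟩
    · rw [← hj, hκ1 j fun i hi => hmax i (hi.trans hj)]; exact hzv j
    · rw [hκ, dif_neg hno, hx]; exact hZ
  · obtain ⟨T, -, hle⟩ := hinv k
    exact hle.trans (hc T)

/-- A feasible point of the finite-horizon problem is turned into an admissible feedback law of no
larger infinite-horizon cost. -/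
theorem exists_law_of_feasible {x xsp : Fin n → ℝ} {usp : Fin m → ℝ} {u : ℕ → Fin m → ℝ}
    (hf : M.TrackFeasible x u xsp usp) :
    ∃ κ, M.AdmissibleFrom κ x ∧ ∀ J, ∑ j ∈ Finset.range J,
      M.stage xsp usp (M.closedLoop κ x j) (κ (M.closedLoop κ x j)) ≤ M.regCost x u xsp usp := by
  obtain ⟨-, hsp, -⟩ := hM.Omega_invariant _ _ _ hf.2
  have heq : xsp = M.next xsp usp := hsp.1
  have hZ : (xsp, usp) ∈ M.Z := hM.Zsp_subset hsp
  obtain ⟨F, hF⟩ : ∃ F, F = M.A + M.B * M.K := ⟨_, rfl⟩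
  obtain ⟨e, he⟩ : ∃ e, e = M.traj x u M.N - xsp := ⟨_, rfl⟩
  obtain ⟨z, hzlt, hzge⟩ : ∃ z : ℕ → Fin n → ℝ, (∀ j ≤ M.N, z j = M.traj x u j) ∧
      ∀ i, z (M.N + i) = xsp + F ^ i *ᵥ e := by
    refine ⟨fun j => if j < M.N then M.traj x u j else xsp + F ^ (j - M.N) *ᵥ e,
      fun j hj => ?_, fun i => by simp⟩
    rcases hj.lt_or_eq with h | rfl
    · simp [h]
    · simp [he]
  obtain ⟨v, hvlt, hvge⟩ : ∃ v : ℕ → Fin m → ℝ, (∀ j < M.N, v j = u j) ∧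
      ∀ i, v (M.N + i) = M.K *ᵥ (F ^ i *ᵥ e) + usp :=
    ⟨fun j => if j < M.N then u j else M.K *ᵥ (F ^ (j - M.N) *ᵥ e) + usp,
      fun j hj => by simp [hj], fun i => by simp⟩
  have hstep : ∀ e' : Fin n → ℝ, M.next (xsp + e') (M.K *ᵥ e' + usp) = xsp + F *ᵥ e' := fun e' => by
    nth_rewrite 2 [heq]
    simp only [next, hF, Matrix.mulVec_add, Matrix.add_mulVec, Matrix.mulVec_mulVec]
    abel
  have hsplit : ∀ j, j < M.N ∨ ∃ i, j = M.N + i := fun j =>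
    (lt_or_ge j M.N).imp_right Nat.exists_eq_add_of_le
  have hz : ∀ j, z (j + 1) = M.next (z j) (v j) := fun j => by
    rcases hsplit j with h | ⟨i, rfl⟩
    · rw [hzlt _ h, hzlt _ h.le, hvlt _ h, traj]
    · rw [add_assoc, hzge, hzge, hvge, hstep, pow_succ', Matrix.mulVec_mulVec]
  have hOm : ∀ i, (z (M.N + i), xsp, usp) ∈ M.Omega := fun i => by
    induction i with
    | zero => rw [add_zero, hzlt _ le_rfl]; exact hf.2
    | succ i ih =>
      have := (hM.Omega_invariant _ _ _ ih).2.2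
      rw [hzge, add_sub_cancel_left, hstep] at this
      rwa [hzge, pow_succ', ← Matrix.mulVec_mulVec]
  have hzv : ∀ j, (z j, v j) ∈ M.Z := fun j => by
    rcases hsplit j with h | ⟨i, rfl⟩
    · rw [hzlt _ h.le, hvlt _ h]; exact hf.1 j h
    · have := (hM.Omega_invariant _ _ _ (hOm i)).1
      rw [hzge, add_sub_cancel_left] at this
      rwa [hzge, hvge]
  -- A state seen twice after time `N` gives a periodic error of the terminal loop, which is zero.
  have hvis : ∀ s, (∀ J, ∃ j, J ≤ j ∧ z j = s) → s = xsp := fun s hs => by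
    obtain ⟨j, hj, rfl⟩ := hs M.N
    obtain ⟨i, rfl⟩ := Nat.exists_eq_add_of_le hj
    obtain ⟨j', hj', h⟩ := hs (M.N + i + 1)
    obtain ⟨k, rfl⟩ := Nat.exists_eq_add_of_le hj'
    rw [show M.N + i + 1 + k = M.N + (k + 1 + i) by ring, hzge, hzge, add_right_inj, pow_add,
      ← Matrix.mulVec_mulVec, hF] at h
    rw [hzge, hF, hM.eq_zero_of_periodic (Nat.succ_pos k) h, add_zero]
  have hc : ∀ J, ∑ j ∈ Finset.range J, M.stage xsp usp (z j) (v j) ≤ M.regCost x u xsp usp := by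
    intro J
    refine (Finset.sum_le_sum_of_subset_of_nonneg
      (Finset.range_mono (Nat.le_add_left J M.N)) fun i _ _ => hM.stage_nonneg _ _ _ _).trans ?_
    rw [Finset.sum_range_add, regCost, ← he]
    refine add_le_add (Finset.sum_le_sum fun j hj => ?_) ?_
    · rw [Finset.mem_range] at hj
      rw [hzlt _ hj.le, hvlt _ hj, stage]
    · have h1 := hM.wsq_P_pow_le e J
      have h2 := wsq_nonneg hM.P_posDef.posSemidef ((M.A + M.B * M.K) ^ J *ᵥ e)
      simp only [stage, hzge, hvge, add_sub_cancel_left, add_sub_cancel_right, hF]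
      linarith
  have := hM.exists_law_of_sequence heq hZ hz hzv hvis hc
  rwa [hzlt 0 (Nat.zero_le _)] at this

theorem Vinf_le_iff {xsp x : Fin n → ℝ} {usp : Fin m → ℝ} {κ : (Fin n → ℝ) → (Fin m → ℝ)} {c : ℝ}
    (hc : 0 ≤ c) :
    M.Vinf xsp usp κ x ≤ ENNReal.ofReal c ↔ ∀ J, ∑ j ∈ Finset.range J,
      M.stage xsp usp (M.closedLoop κ x j) (κ (M.closedLoop κ x j)) ≤ c := by
  have h0 : ∀ J, ∑ j ∈ Finset.range J,
      M.stage xsp usp (M.closedLoop κ x j) (κ (M.closedLoop κ x j)) ≤ c ↔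
      ∑ j ∈ Finset.range J, ENNReal.ofReal
        (M.stage xsp usp (M.closedLoop κ x j) (κ (M.closedLoop κ x j))) ≤ ENNReal.ofReal c :=
    fun J => by
      rw [← ENNReal.ofReal_sum_of_nonneg fun j _ => hM.stage_nonneg _ _ _ _,
        ENNReal.ofReal_le_ofReal_iff hc]
  simp only [h0]
  exact ⟨fun h J => (ENNReal.sum_le_tsum _).trans h, ENNReal.tsum_le_of_sum_range_le⟩

theorem regCost_nonneg (x : Fin n → ℝ) (u : ℕ → Fin m → ℝ) (xa : Fin n → ℝ) (ua : Fin m → ℝ) :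
    0 ≤ M.regCost x u xa ua :=
  add_nonneg (Finset.sum_nonneg fun _ _ => hM.stage_nonneg _ _ _ _)
    (wsq_nonneg hM.P_posDef.posSemidef _)

/-- In the region where the infinite-horizon optimal law reaches the terminal set within the
horizon, its open-loop input sequence solves the problem of the MPC for regulation. -/
theorem optimalLaw_minimizes (hL : M.IsLQR) {x xsp : Fin n → ℝ} {usp : Fin m → ℝ}
    {κ : (Fin n → ℝ) → (Fin m → ℝ)} (hκ : M.IsOptimalLaw xsp usp κ)
    (hx : x ∈ M.Upsilon xsp usp κ) :
    M.TrackFeasible x (fun j => κ (M.closedLoop κ x j)) xsp usp ∧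
      ∀ u, M.TrackFeasible x u xsp usp →
        M.regCost x (fun j => κ (M.closedLoop κ x j)) xsp usp ≤ M.regCost x u xsp usp := by
  have ht : ∀ j, M.traj x (fun j => κ (M.closedLoop κ x j)) j = M.closedLoop κ x j := fun j => by
    induction j with
    | zero => rfl
    | succ j ih => rw [traj, ih, closedLoop]
  refine ⟨⟨fun j _ => by rw [ht]; exact hx.1 j, by rw [ht]; exact hx.2⟩, fun u hu => ?_⟩
  have heq : xsp = M.next xsp usp := (hM.Omega_invariant _ _ _ hx.2).2.1.1
  obtain ⟨κ', hadm, hle⟩ := hM.exists_law_of_feasible hu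
  have h0 := hM.regCost_nonneg x u xsp usp
  -- The plan's finite-horizon cost bounds the infinite cost of the optimal law, which in turn
  -- dominates that law's own finite-horizon cost.
  have h1 := (hM.Vinf_le_iff h0).1
    (((hκ x ⟨κ, hx.1⟩).2 κ' hadm).trans ((hM.Vinf_le_iff h0).2 hle))
  have h2 := hM.lqr_lower_bound hL (e := fun j => M.closedLoop κ x j - xsp)
    (v := fun j => κ (M.closedLoop κ x j) - usp) (fun j => by
      rw [next_sub, ← heq]; rfl) h1 M.N
  simpa only [regCost, ht] using h2

end Standing
end Design
end MPCT

/-! ### Equivalence of the two controllers and local optimality. -/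

theorem mainTheorem3 {n m p : ℕ} (M : MPCT.Design n m p) (hM : M.Standing)
    (nrm : Seminorm ℝ (Fin p → ℝ)) (hnrm : ∀ y, nrm y = 0 → y = 0)
    (S : Set ((Fin n → ℝ) × (Fin p → ℝ)))
    (hS : Bornology.IsBounded M.Z ∨ Bornology.IsBounded S) :
    ∃ γstar : ℝ, 0 < γstar ∧ ∀ γ : ℝ, γstar ≤ γ →
      ∀ (VO : (Fin p → ℝ) → (Fin p → ℝ) → ℝ) (ysp : Fin p → ℝ),
        M.IsOffsetCost VO ysp →
        (∀ y ∈ M.Ysp, γ * nrm (y - ysp) ≤ VO y ysp) →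
        (∀ x ∈ M.regRegion ysp, (x, ysp) ∈ S →
          (∃ V : ℝ, IsLeast (M.trackValues VO x ysp) V ∧ IsLeast (M.regValues x ysp) V) ∧
          M.trackLaw VO x ysp = M.regLaw x ysp ∧
          (M.regLaw x ysp).Nonempty ∧
          ((∀ v : Fin m → ℝ, Matrix.mulVec M.B v = 0 → Matrix.mulVec M.D v = 0 → v = 0) →
            ∃ v : Fin m → ℝ, M.trackLaw VO x ysp = {v} ∧ M.regLaw x ysp = {v})) ∧
        (M.IsLQR →
          ∀ (xsp : Fin n → ℝ) (usp : Fin m → ℝ), M.IsTheEquilibrium ysp xsp usp →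
          ∀ κ : (Fin n → ℝ) → (Fin m → ℝ), M.IsOptimalLaw xsp usp κ →
          ∀ x ∈ M.Upsilon xsp usp κ, (x, ysp) ∈ S →
            M.trackLaw VO x ysp = {κ x}) := by
  obtain ⟨g, hg0, hg⟩ := hM.exists_penalty_bound hS
  obtain ⟨b, hb0, hb⟩ := MPCT.exists_norm_le_seminorm nrm hnrm
  -- `g` is the penalty constant in the sup norm, `b` converts it to the given norm, and the extra
  -- `1` makes the penalty strict.
  refine ⟨g * b + 1, by positivity, fun γ hγ VO ysp hVO hVOγ => ?_⟩
  have hzero : VO ysp ysp = 0 := (hVO.eq_zero_iff ysp).2 rfl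
  have htrack : ∀ {x u xa ua}, M.out xa ua = ysp →
      M.trackCost VO x ysp u xa ua = M.regCost x u xa ua := fun h => by
    rw [MPCT.Design.trackCost, h, hzero, add_zero]
  -- strict exactness of the penalty
  have hexact : ∀ x ∈ M.regRegion ysp, (x, ysp) ∈ S → ∀ V : ℝ,
      (∀ u xa ua, M.RegFeasible x ysp u xa ua → V ≤ M.regCost x u xa ua) →
      ∀ u xa ua, M.TrackFeasible x u xa ua →
        V + nrm (M.out xa ua - ysp) ≤ M.trackCost VO x ysp u xa ua := by
    intro x hx hxS V hV u xa ua hf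
    obtain ⟨u', xa', ua', hf', hle⟩ := hg x ysp hx hxS u xa ua hf
    have h1 := hV u' xa' ua' hf'
    have h2 := hVOγ _ ⟨(xa, ua), (hM.Omega_invariant _ _ _ hf.2).2.1, rfl⟩
    have h3 := mul_le_mul_of_nonneg_left (hb (M.out xa ua - ysp)) hg0
    have h4 := mul_le_mul_of_nonneg_right hγ (apply_nonneg nrm (M.out xa ua - ysp))
    simp only at h2
    rw [MPCT.Design.trackCost]
    linarith
  have hlaw : ∀ x ∈ M.regRegion ysp, (x, ysp) ∈ S → M.trackLaw VO x ysp = M.regLaw x ysp := by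
    intro x hx hxS
    obtain ⟨u₀, xa₀, ua₀, hf₀, hmin₀⟩ := hM.exists_reg_minimizer hx
    have hE := hexact x hx hxS _ hmin₀
    ext w
    constructor
    · rintro ⟨u, xa, ua, hf, hmin, rfl⟩
      have h1 := hE u xa ua hf
      have h2 := hmin _ _ _ hf₀.1
      rw [htrack hf₀.2] at h2
      have h3 : M.out xa ua = ysp := sub_eq_zero.1 (hnrm _
        (le_antisymm (by linarith) (apply_nonneg nrm _)))
      rw [htrack h3] at h2
      exact ⟨u, xa, ua, ⟨hf, h3⟩, fun u' xa' ua' h' => h2.trans (hmin₀ _ _ _ h'), rfl⟩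
    · rintro ⟨u, xa, ua, hf, hmin, rfl⟩
      refine ⟨u, xa, ua, hf.1, fun u' xa' ua' h' => ?_, rfl⟩
      have h1 := hexact x hx hxS _ hmin u' xa' ua' h'
      have h2 := apply_nonneg nrm (M.out xa' ua' - ysp)
      rw [htrack hf.2]
      linarith
  refine ⟨fun x hx hxS => ?_, fun hL xsp usp heq κ hκ x hx hxS => ?_⟩
  · obtain ⟨u₀, xa₀, ua₀, hf₀, hmin₀⟩ := hM.exists_reg_minimizer hx
    refine ⟨⟨M.regCost x u₀ xa₀ ua₀, ⟨⟨u₀, xa₀, ua₀, hf₀.1, (htrack hf₀.2).symm⟩, ?_⟩,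
      ⟨⟨u₀, xa₀, ua₀, hf₀, rfl⟩, ?_⟩⟩, hlaw x hx hxS, ⟨u₀ 0, u₀, xa₀, ua₀, hf₀, hmin₀, rfl⟩,
      fun hker => ?_⟩
    · rintro _ ⟨u, xa, ua, hf, rfl⟩
      have h1 := hexact x hx hxS _ hmin₀ u xa ua hf
      have h2 := apply_nonneg nrm (M.out xa ua - ysp)
      linarith
    · rintro _ ⟨u, xa, ua, hf, rfl⟩
      exact hmin₀ u xa ua hf
    · have hsing : M.regLaw x ysp = {u₀ 0} := by
        refine Set.eq_singleton_iff_unique_mem.2 ⟨⟨u₀, xa₀, ua₀, hf₀, hmin₀, rfl⟩, ?_⟩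
        rintro _ ⟨u, xa, ua, hf, hmin, rfl⟩
        obtain ⟨h1, h2, h3⟩ := hM.reg_minimizers_diff hf hf₀ hmin hmin₀
        rw [hker _ h2 h3] at h1
        exact sub_eq_zero.1 h1
      exact ⟨u₀ 0, (hlaw x hx hxS).trans hsing, hsing⟩
  · obtain ⟨hf₀, hmin₀⟩ := hM.optimalLaw_minimizes hL hκ hx
    -- Uniqueness of the admissible equilibrium fixes `u_a`, so the first input is unique without a
    -- kernel condition.
    have huniq : ∀ {u xa ua}, M.RegFeasible x ysp u xa ua → xa = xsp ∧ ua = usp := fun h =>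
      Prod.mk.inj (heq.2.2 _ (hM.Omega_invariant _ _ _ h.1.2).2.1 h.2)
    have hmin₁ : ∀ u xa ua, M.RegFeasible x ysp u xa ua →
        M.regCost x (fun j => κ (M.closedLoop κ x j)) xsp usp ≤ M.regCost x u xa ua := by
      intro u xa ua h
      obtain ⟨rfl, rfl⟩ := huniq h
      exact hmin₀ u h.1
    have hf₁ : M.RegFeasible x ysp (fun j => κ (M.closedLoop κ x j)) xsp usp := ⟨hf₀, heq.2.1⟩
    rw [hlaw x ⟨_, _, _, hf₁⟩ hxS]
    refine Set.eq_singleton_iff_unique_mem.2 ⟨⟨_, _, _, hf₁, hmin₁, rfl⟩, ?_⟩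
    rintro _ ⟨u, xa, ua, hf, hmin, rfl⟩
    obtain ⟨h1, -, -⟩ := hM.reg_minimizers_diff hf hf₁ hmin hmin₁
    rw [(huniq hf).2, sub_self] at h1
    exact sub_eq_zero.1 h1
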